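/- For $n\ge 1$ let $\omega_n=e^{2\pi i/n}$, let $\mathbb Z[\omega_n]\subset\mathbb C$ be the ring generated by $\omega_n$, and let $\mathcal A_n=\{\omega_n^j : j\in\mathbb Z\}\cup\{0\}$. Let $\tau=\frac{1+\sqrt5}{2}$ and $\delta=1+\sqrt2$, and let $(\beta,n)$ be one of the pairs $(\tau,10)$, $(\tau^2,10)$, $(\delta,8)$; then $\beta\in\mathbb Z[\omega_n]$. Write $\mathcal A=\mathcal A_n$ and let $$X^{\mathcal A}(\beta)=\Big\{\sum_{j=0}^m a_j\beta^j : m\in\mathbb N,\ a_j\in\mathcal A\Big\}$$ be the spectrum of $\beta$ with alphabet $\mathcal A$. Let $\sigma$ be a ring automorphism of $\mathbb Z[\omega_n]$ with $|\sigma(\beta)|<1$, that is, one that sends $\beta$ to its algebraic conjugate $\beta'\neq\beta$. Put $$K(\sigma(\beta),\mathcal A)=\Big\{\sum_{i=0}^{\infty}a_i\,\sigma(\beta)^i : a_i\in\mathcal A\Big\},\qquad \Omega=\mathrm{int}\big(K(\sigma(\beta),\mathcal A)\big)\subset\mathbb C,$$ $$\Sigma(\Omega)=\{z\in\mathbb Z[\omega_n]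 : \sigma(z)\in\Omega\},$$ and let $\overline{B}=\{z\in\mathbb C : |z|\le \frac1{\beta-1}\}$. Then the following are equivalent: 1. $\Sigma(\Omega)\cap\overline{B}\subseteq X^{\mathcal A}(\beta)\cap\overline{B}$; 2. $\Sigma(\Omega)\subseteq X^{\mathcal A}(\beta)$. -/

import Mathlib

noncomputable section

/-- The standard primitive `n`-th root of unity `ω = exp(2πi/n)`. -/
def rootOfUnity (n : ℕ) : ℂ := Complex.exp (2 * Real.pi * Complex.I / n)

/-- The ring of cyclotomic integers `ℤ[ω]`, as a subring of `ℂ`. -/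
def cyclotomicIntegers (n : ℕ) : Subalgebra ℤ ℂ := Algebra.adjoin ℤ {rootOfUnity n}

/-- The alphabet `𝒜_n = {ω ^ j : j ∈ ℤ} ∪ {0}`. -/
def polygonAlphabet (n : ℕ) : Set ℂ := Set.range (fun j : ℤ => rootOfUnity n ^ j) ∪ {0}

/-- The spectrum `X^B(β)`: all values at `β` of polynomials with coefficients in `B`. -/
def spectrumOf (B : Set ℂ) (β : ℂ) : Set ℂ :=
  {z | ∃ (m : ℕ) (a : ℕ → ℂ), (∀ j, a j ∈ B) ∧ z = ∑ j ∈ Finset.range (m + 1), a j * β ^ j}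

/-- `K(γ, B)`: the sums of convergent power series at `γ` with coefficients in `B`. -/
def attractorK (γ : ℂ) (B : Set ℂ) : Set ℂ :=
  {z | ∃ a : ℕ → ℂ, (∀ i, a i ∈ B) ∧ HasSum (fun i => a i * γ ^ i) z}

/-- The cut-and-project set `Σ(Ω) = {z ∈ ℤ[ω] : σ(z) ∈ Ω}` given by an automorphism `σ`
of `ℤ[ω]` and an acceptance window `Ω ⊆ ℂ`. -/
def cutAndProject (n : ℕ) (σ : cyclotomicIntegers n ≃+* cyclotomicIntegers n) (Ω : Set ℂ) :
    Set ℂ :=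
  {z | ∃ w : cyclotomicIntegers n, (w : ℂ) = z ∧ (σ w : ℂ) ∈ Ω}

/-- The silver mean `δ = 1 + √2`, the larger root of `x² - 2x - 1`. -/
def silverMean : ℝ := 1 + √2

/-- The pairs (order, base) `(10, τ)`, `(10, τ²)`, `(8, δ)`, with `τ` the golden ratio. -/
def IsAdmissiblePair (n : ℕ) (β : ℝ) : Prop :=
  (n = 10 ∧ β = Real.goldenRatio) ∨ (n = 10 ∧ β = Real.goldenRatio ^ 2) ∨
    (n = 8 ∧ β = silverMean)

theorem two_cos_mem (n : ℕ) :
    ((2 * Real.cos (2 * Real.pi / n) : ℝ) : ℂ) ∈ cyclotomicIntegers n := by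
  rcases Nat.eq_zero_or_pos n with rfl | hn
  · have : ((2 * Real.cos (2 * Real.pi / (0 : ℕ)) : ℝ) : ℂ) = ((2 : ℤ) : ℂ) := by simp
    rw [this]
    exact (cyclotomicIntegers 0).intCast_mem 2
  have h1 : rootOfUnity n ∈ cyclotomicIntegers n :=
    Algebra.subset_adjoin (Set.mem_singleton _)
  have hω : rootOfUnity n ^ n = 1 := (Complex.isPrimitiveRoot_exp n hn.ne').pow_eq_one
  have h2 : (rootOfUnity n)⁻¹ ∈ cyclotomicIntegers n := by
    have : (rootOfUnity n)⁻¹ = rootOfUnity n ^ (n - 1) := by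
      refine inv_eq_of_mul_eq_one_right ?_
      rw [← pow_succ', Nat.sub_add_cancel hn, hω]
    rw [this]
    exact pow_mem h1 _
  have h3 : ((2 * Real.cos (2 * Real.pi / n) : ℝ) : ℂ)
      = rootOfUnity n + (rootOfUnity n)⁻¹ := by
    unfold rootOfUnity
    rw [← Complex.exp_neg]
    push_cast
    rw [Complex.two_cos]
    congr 2 <;> ring
  rw [h3]
  exact add_mem h1 h2

theorem IsAdmissiblePair.mem {n : ℕ} {β : ℝ} (h : IsAdmissiblePair n β) :
    (β : ℂ) ∈ cyclotomicIntegers n := by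
  have h10 : ((Real.goldenRatio : ℝ) : ℂ) ∈ cyclotomicIntegers 10 := by
    have := two_cos_mem 10
    have e : 2 * Real.cos (2 * Real.pi / (10 : ℕ)) = Real.goldenRatio := by
      have : 2 * Real.pi / (10 : ℕ) = Real.pi / 5 := by push_cast; ring
      rw [this, Real.cos_pi_div_five, Real.goldenRatio]; ring
    rwa [e] at this
  rcases h with ⟨rfl, rfl⟩ | ⟨rfl, rfl⟩ | ⟨rfl, rfl⟩
  · exact h10
  · rw [Complex.ofReal_pow]
    exact pow_mem h10 2
  · have := two_cos_mem 8
    have e : 2 * Real.cos (2 * Real.pi / (8 : ℕ)) = √2 := by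
      have : 2 * Real.pi / (8 : ℕ) = Real.pi / 4 := by push_cast; ring
      rw [this, Real.cos_pi_div_four]; ring
    rw [e] at this
    unfold silverMean
    push_cast
    exact add_mem (one_mem _) this

/-- The base `β` as an element of `ℤ[ω]`. -/
def baseElt {n : ℕ} {β : ℝ} (h : IsAdmissiblePair n β) : cyclotomicIntegers n := ⟨β, h.mem⟩

end

open Filter Topology

/-! ### The alphabet, the spectrum and the attractor -/

/-! The content is the passage from the ball to the whole plane, and the tool is division by β.
Since β is a unit of ℤ[ω] and K is the union of the sets a + σ(β)K, every z with σ(z) ∈ K has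
expansions z = a₀ + a₁β + … + β^k y with digits aⱼ and σ(y) ∈ K (`exists_residue_of_covered`). If
one such residue y lies in the spectrum, so does z. Moreover |y| ≤ |z|/β^k + 1/(β-1), so residues
come arbitrarily close to the ball. As |y|² = p + qs with integers p, q, and |σ(y)|² is its
algebraic conjugate, bounds on both leave finitely many values.

For δ the bounds give |y|²|σ(y)|² < 2, which leaves only y = 0, an element of the spectrum:
statement 2 holds outright.

For τ the window Ω is an open decagon covered by its own ten contractions. Residues can therefore be
kept inside Ω, by discreteness they end up inside the closed ball, and statement 1 applies to them.

For τ² the possible residues are 0 and the ten vertices (1-τ)ω^i, whose conjugates lie on the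
boundary of K. If z is not in the spectrum, only vertices occur, and two vertices three or more
steps apart never occur at the same level (`not_residue_pair`); so those that occur lie among three
consecutive ones. As σ(z) is interior, small perturbations of it stay in K and can be divided along
with it. Their direction is chosen to point out of the disc around K at the middle vertex, and along
an edge of the convex hull of K at its two neighbours. On that edge K is a Cantor set, and the
perturbed point falls into a gap (`vertex_add_notMem_attractorK`). So statement 2 again holds
outright. -/

theorem mem_polygonAlphabet_iff {n : ℕ} (hn : 0 < n) {x : ℂ} :
    x ∈ polygonAlphabet n ↔ x = 0 ∨ x ^ n = 1 := by
  have hp : IsPrimitiveRoot (rootOfUnity n) n := Complex.isPrimitiveRoot_exp n hn.ne'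
  constructor
  · rintro (⟨j, rfl⟩ | hx)
    · right
      change (rootOfUnity n ^ j) ^ n = 1
      rw [← zpow_natCast, ← zpow_mul, mul_comm, zpow_mul, zpow_natCast, hp.pow_eq_one, one_zpow]
    · exact Or.inl hx
  · rintro (rfl | hx)
    · exact Or.inr rfl
    · have : NeZero n := ⟨hn.ne'⟩
      obtain ⟨i, -, hi⟩ := hp.eq_pow_of_pow_eq_one hx
      exact Or.inl ⟨i, by simpa using hi⟩

theorem zero_mem_polygonAlphabet (n : ℕ) : (0 : ℂ) ∈ polygonAlphabet n := Or.inr rfl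

theorem norm_eq_one_of_pow_eq_one {n : ℕ} (hn : 0 < n) {x : ℂ} (hx : x ^ n = 1) : ‖x‖ = 1 :=
  Complex.norm_eq_one_of_pow_eq_one hx hn.ne'

theorem norm_le_one_of_mem_polygonAlphabet {n : ℕ} (hn : 0 < n) {x : ℂ}
    (hx : x ∈ polygonAlphabet n) : ‖x‖ ≤ 1 := by
  rcases (mem_polygonAlphabet_iff hn).1 hx with rfl | hx
  · simp
  · exact (norm_eq_one_of_pow_eq_one hn hx).le

theorem finite_polygonAlphabet {n : ℕ} (hn : 0 < n) : (polygonAlphabet n).Finite := by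
  have : polygonAlphabet n ⊆ (fun i : ℕ => rootOfUnity n ^ i) '' Set.Iio n ∪ {0} := by
    rintro x hx
    rcases (mem_polygonAlphabet_iff hn).1 hx with rfl | hx
    · exact Or.inr rfl
    · have : NeZero n := ⟨hn.ne'⟩
      obtain ⟨i, hi, rfl⟩ :=
        (Complex.isPrimitiveRoot_exp n hn.ne').eq_pow_of_pow_eq_one hx
      exact Or.inl ⟨i, hi, rfl⟩
  exact (((Set.finite_Iio n).image _).union (Set.finite_singleton 0)).subset this

theorem zero_mem_spectrumOf {B : Set ℂ} {β : ℂ} (h0 : (0 : ℂ) ∈ B) : (0 : ℂ) ∈ spectrumOf B β :=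
  ⟨0, fun _ => 0, fun _ => h0, by simp⟩

theorem add_mul_mem_spectrumOf {B : Set ℂ} {β a y : ℂ} (ha : a ∈ B) (hy : y ∈ spectrumOf B β) :
    a + β * y ∈ spectrumOf B β := by
  obtain ⟨m, c, hc, rfl⟩ := hy
  refine ⟨m + 1, fun j => Nat.casesOn j a c, ?_, ?_⟩
  · rintro (_ | j)
    · exact ha
    · exact hc j
  · rw [Finset.sum_range_succ' _ (m + 1), Finset.mul_sum, add_comm]
    simp only [pow_zero, mul_one]
    congr 1
    refine Finset.sum_congr rfl fun j _ => ?_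
    rw [pow_succ]; ring

theorem mem_spectrumOf_of_mem {B : Set ℂ} {β a : ℂ} (ha : a ∈ B) : a ∈ spectrumOf B β :=
  ⟨0, fun _ => a, fun _ => ha, by simp⟩

theorem exists_eq_add_mul_of_mem_attractorK {B : Set ℂ} {γ x : ℂ} (hγ : γ ≠ 0)
    (hx : x ∈ attractorK γ B) : ∃ a ∈ B, ∃ y ∈ attractorK γ B, x = a + γ * y := by
  obtain ⟨c, hc, hs⟩ := hx
  refine ⟨c 0, hc 0, γ⁻¹ * (x - c 0), ⟨fun i => c (i + 1), fun i => hc _, ?_⟩, ?_⟩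
  · have := (hasSum_nat_add_iff' 1).2 hs
    simp only [Finset.range_one, Finset.sum_singleton, pow_zero, mul_one] at this
    have e : (fun i => c (i + 1) * γ ^ i) = fun i => γ⁻¹ * (c (i + 1) * γ ^ (i + 1)) := by
      funext i; rw [pow_succ]; field_simp
    simpa only [e] using this.mul_left γ⁻¹
  · field_simp; ring

theorem norm_le_of_mem_attractorK {B : Set ℂ} {γ x : ℂ} (hB : ∀ a ∈ B, ‖a‖ ≤ 1) (hγ : ‖γ‖ < 1)
    (hx : x ∈ attractorK γ B) : ‖x‖ ≤ (1 - ‖γ‖)⁻¹ := by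
  obtain ⟨c, hc, hs⟩ := hx
  rw [← hs.tsum_eq]
  refine tsum_of_norm_bounded (hasSum_geometric_of_lt_one (norm_nonneg _) hγ) fun i => ?_
  rw [norm_mul, norm_pow]
  exact mul_le_of_le_one_left (by positivity) (hB _ (hc i))

theorem summable_of_norm_le_one {γ : ℂ} (hγ : ‖γ‖ < 1) {c : ℕ → ℂ} (hc : ∀ i, ‖c i‖ ≤ 1) :
    Summable fun i => c i * γ ^ i := by
  refine Summable.of_norm_bounded (summable_geometric_of_lt_one (norm_nonneg _) hγ) fun i => ?_
  rw [norm_mul, norm_pow]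
  exact mul_le_of_le_one_left (by positivity) (hc i)

/-- The digit sequences form a compact product space, and summing the series is continuous on it. -/
theorem isClosed_attractorK {B : Set ℂ} {γ : ℂ} (hB : ∀ a ∈ B, ‖a‖ ≤ 1) (hfin : B.Finite)
    (hγ : ‖γ‖ < 1) : IsClosed (attractorK γ B) := by
  have : Finite B := hfin
  have himg : attractorK γ B = Set.range fun c : ℕ → B => ∑' i, (c i : ℂ) * γ ^ i := by
    ext x
    constructor
    · rintro ⟨c, hc, hs⟩
      exact ⟨fun i => ⟨c i, hc i⟩, hs.tsum_eq⟩
    · rintro ⟨c, rfl⟩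
      exact ⟨fun i => c i, fun i => (c i).2,
        (summable_of_norm_le_one hγ fun i => hB _ (c i).2).hasSum⟩
  rw [himg]
  refine (isCompact_range ?_).isClosed
  refine continuous_tsum (fun i => by fun_prop)
    (summable_geometric_of_lt_one (norm_nonneg _) hγ) fun i c => ?_
  rw [norm_mul, norm_pow]
  exact mul_le_of_le_one_left (by positivity) (hB _ (c i).2)

theorem mul_mem_attractorK {B : Set ℂ} {γ u x : ℂ} (hu : ∀ a ∈ B, u * a ∈ B)
    (hx : x ∈ attractorK γ B) : u * x ∈ attractorK γ B := by
  obtain ⟨c, hc, hs⟩ := hx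
  refine ⟨fun i => u * c i, fun i => hu _ (hc i), ?_⟩
  simpa only [mul_assoc] using hs.mul_left u

/-- A bounded set covered by its images under the maps `x ↦ a + γ x` lies in the attractor. -/
theorem subset_attractorK_of_covered {B W : Set ℂ} {γ : ℂ} {C : ℝ} (hγ : ‖γ‖ < 1)
    (hC : ∀ x ∈ W, ‖x‖ ≤ C) (hB : ∀ a ∈ B, ‖a‖ ≤ 1)
    (hW : ∀ x ∈ W, ∃ a ∈ B, ∃ y ∈ W, x = a + γ * y) : W ⊆ attractorK γ B := by
  intro x hx
  choose! d hd f hf hdf using hW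
  -- Iterating the covering gives an orbit in `W` whose successive digits expand `x`; the remainder
  -- γ^k · o k vanishes because `W` is bounded.
  let o : ℕ → ℂ := fun k => f^[k] x
  have ho : ∀ k, o k ∈ W := by
    intro k
    induction k with
    | zero => exact hx
    | succ k ih => simp only [o, Function.iterate_succ_apply'] at ih ⊢; exact hf _ ih
  have hstep : ∀ k, o k = d (o k) + γ * o (k + 1) := by
    intro k
    have := hdf _ (ho k)
    simpa only [o, Function.iterate_succ_apply'] using this
  have hsum : ∀ k, ∑ i ∈ Finset.range k, d (o i) * γ ^ i = x - γ ^ k * o k := by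
    intro k
    induction k with
    | zero => simp [o]
    | succ k ih => rw [Finset.sum_range_succ, ih]; linear_combination (-γ ^ k) * hstep k
  refine ⟨fun i => d (o i), fun i => hd _ (ho i), ?_⟩
  have hs := summable_of_norm_le_one hγ fun i => hB _ (hd _ (ho i))
  refine (hs.hasSum_iff_tendsto_nat).2 ?_
  simp only [hsum]
  have h0 : Tendsto (fun k => γ ^ k * o k) atTop (𝓝 0) := by
    refine squeeze_zero_norm (a := fun k => ‖γ‖ ^ k * C) (fun k => ?_) ?_
    · rw [norm_mul, norm_pow]
      exact mul_le_mul_of_nonneg_left (hC _ (ho k)) (by positivity)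
    · simpa using (tendsto_pow_atTop_nhds_zero_of_lt_one (norm_nonneg γ) hγ).mul_const C
  simpa using tendsto_const_nhds.sub h0

/-! ### Residues of cyclotomic integers -/

/-- An element of `ℤ[ω]` is a digit if it lies in the alphabet. -/
def IsDigit {n : ℕ} (a : cyclotomicIntegers n) : Prop := (a : ℂ) ∈ polygonAlphabet n

theorem isDigit_iff {n : ℕ} (hn : 0 < n) {a : cyclotomicIntegers n} :
    IsDigit a ↔ a = 0 ∨ a ^ n = 1 := by
  rw [IsDigit, mem_polygonAlphabet_iff hn, Subtype.ext_iff, Subtype.ext_iff]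
  simp

theorem isDigit_map {n : ℕ} (hn : 0 < n) (σ : cyclotomicIntegers n ≃+* cyclotomicIntegers n)
    {a : cyclotomicIntegers n} : IsDigit (σ a) ↔ IsDigit a := by
  rw [isDigit_iff hn, isDigit_iff hn, ← map_pow, EmbeddingLike.map_eq_one_iff,
    EmbeddingLike.map_eq_zero_iff]

/-- An automorphism permutes the n-th roots of unity, so digits chosen on the conjugate side lift to
digits. -/
theorem exists_isDigit_of_mem {n : ℕ} (hn : 0 < n)
    (σ : cyclotomicIntegers n ≃+* cyclotomicIntegers n) {x : ℂ} (hx : x ∈ polygonAlphabet n) :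
    ∃ a : cyclotomicIntegers n, IsDigit a ∧ (σ a : ℂ) = x := by
  have hmem : x ∈ cyclotomicIntegers n := by
    rcases (mem_polygonAlphabet_iff hn).1 hx with rfl | hx
    · exact zero_mem _
    · have : NeZero n := ⟨hn.ne'⟩
      obtain ⟨i, hi, rfl⟩ :=
        (Complex.isPrimitiveRoot_exp n hn.ne').eq_pow_of_pow_eq_one hx
      exact pow_mem (Algebra.subset_adjoin (Set.mem_singleton _)) _
  refine ⟨σ.symm ⟨x, hmem⟩, ?_, by simp⟩
  rw [← isDigit_map hn σ]
  simpa [IsDigit] using hx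

/-- `Residue b z k y` says that `z` is a polynomial of degree `< k` in `b` with digits as
coefficients plus `b ^ k * y`. -/
inductive Residue {n : ℕ} (b z : cyclotomicIntegers n) : ℕ → cyclotomicIntegers n → Prop
  | zero : Residue b z 0 z
  | succ {k : ℕ} {a y : cyclotomicIntegers n} :
      Residue b z k (a + b * y) → IsDigit a → Residue b z (k + 1) y

section Residues

variable {n : ℕ} {b z : cyclotomicIntegers n}

theorem Residue.eq_of_zero {y : cyclotomicIntegers n} (h : Residue b z 0 y) : y = z := by
  cases h; rfl

theorem Residue.exists_of_succ {k : ℕ} {y : cyclotomicIntegers n} (h : Residue b z (k + 1) y) :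
    ∃ a, IsDigit a ∧ Residue b z k (a + b * y) := by
  cases h with
  | succ h ha => exact ⟨_, ha, h⟩

/-- Contrapositive of the stability of the spectrum under y ↦ a + βy. -/
theorem Residue.notMem_spectrumOf
    (hz : (z : ℂ) ∉ spectrumOf (polygonAlphabet n) b) {k : ℕ} {y : cyclotomicIntegers n}
    (h : Residue b z k y) : (y : ℂ) ∉ spectrumOf (polygonAlphabet n) b := by
  induction h with
  | zero => exact hz
  | succ _ ha ih => exact fun hy => ih (by simpa using add_mul_mem_spectrumOf ha hy)

/-- Each division maps a bound t to (t + 1)/β, an affine contraction with fixed point 1/(β-1). -/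
theorem Residue.norm_le (hn : 0 < n) {β : ℝ} (hβ : 1 < β) (hb : (b : ℂ) = β) {k : ℕ}
    {y : cyclotomicIntegers n} (h : Residue b z k y) :
    ‖(y : ℂ)‖ ≤ ‖(z : ℂ)‖ / β ^ k + 1 / (β - 1) := by
  have h1 : 0 < β - 1 := by linarith
  induction h with
  | zero => simp [h1.le]
  | @succ k a y _ ha ih =>
    have ha' := norm_le_one_of_mem_polygonAlphabet hn ha
    have h2 : ‖(b : ℂ) * y‖ ≤ ‖(a : ℂ) + b * y‖ + ‖(a : ℂ)‖ := by
      have := norm_sub_le ((a : ℂ) + b * y) a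
      rwa [add_sub_cancel_left] at this
    have h3 : ‖(b : ℂ) * y‖ = β * ‖(y : ℂ)‖ := by
      rw [norm_mul, hb, Complex.norm_real, Real.norm_of_nonneg (by linarith)]
    have h4 : ‖(a : ℂ) + b * y‖ ≤ ‖(z : ℂ)‖ / β ^ k + 1 / (β - 1) := by simpa using ih
    have h5 : β * ‖(y : ℂ)‖ ≤ β * (‖(z : ℂ)‖ / β ^ (k + 1) + 1 / (β - 1)) := by
      have e : β * (‖(z : ℂ)‖ / β ^ (k + 1) + 1 / (β - 1))
          = ‖(z : ℂ)‖ / β ^ k + 1 / (β - 1) + 1 := by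
        rw [pow_succ]; field_simp; ring
      rw [e]; linarith
    exact le_of_mul_le_mul_left h5 (by linarith)

/-- The contribution of `z` cancels: the difference is a finite sum of digit differences, of modulus
at most 2, times negative powers of β. -/
theorem Residue.norm_sub_lt (hn : 0 < n) {β : ℝ} (hβ : 1 < β) (hb : (b : ℂ) = β) {k : ℕ}
    {y y' : cyclotomicIntegers n} (h : Residue b z k y) (h' : Residue b z k y') :
    ‖(y : ℂ) - y'‖ < 2 / (β - 1) := by
  have h1 : 0 < β - 1 := by linarith
  induction k generalizing y y' with
  | zero => rw [h.eq_of_zero, h'.eq_of_zero]; simp [h1]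
  | succ k ih =>
    obtain ⟨a, ha, hr⟩ := h.exists_of_succ
    obtain ⟨a', ha', hr'⟩ := h'.exists_of_succ
    have i0 := ih hr hr'
    have n1 := norm_le_one_of_mem_polygonAlphabet hn ha
    have n2 := norm_le_one_of_mem_polygonAlphabet hn ha'
    have e : (b : ℂ) * (y - y')
        = (((a + b * y : cyclotomicIntegers n) : ℂ) - (a' + b * y' : cyclotomicIntegers n))
          - (a - a') := by push_cast; ring
    have h3 : ‖(b : ℂ) * (y - y')‖ = β * ‖(y : ℂ) - y'‖ := by
      rw [norm_mul, hb, Complex.norm_real, Real.norm_of_nonneg (by linarith)]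
    rw [e] at h3
    have h4 := norm_sub_le (((a + b * y : cyclotomicIntegers n) : ℂ)
      - (a' + b * y' : cyclotomicIntegers n)) ((a : ℂ) - a')
    have h5 := norm_sub_le (a : ℂ) a'
    have h6 : β * ‖(y : ℂ) - y'‖ < β * (2 / (β - 1)) := by
      have e : β * (2 / (β - 1)) = 2 / (β - 1) + 2 := by field_simp; ring
      rw [e]; linarith
    exact lt_of_mul_lt_mul_left h6 (by linarith)

/-- Since `b` is a unit, y - a is divisible by `b` whatever the digit, so a digit may be chosen by
looking at σ(y) alone. -/
theorem exists_eq_add_mul {σ : cyclotomicIntegers n ≃+* cyclotomicIntegers n} (hn : 0 < n)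
    (hb : IsUnit b) {y : cyclotomicIntegers n} {a' x : ℂ} (ha : a' ∈ polygonAlphabet n)
    (hx : (σ y : ℂ) = a' + σ b * x) :
    ∃ a y', IsDigit a ∧ y = a + b * y' ∧ (σ a : ℂ) = a' ∧ (σ y' : ℂ) = x := by
  obtain ⟨a, hda, rfl⟩ := exists_isDigit_of_mem hn σ ha
  obtain ⟨c, hc⟩ := hb.exists_right_inv
  have hc' : (σ b : ℂ) * σ c = 1 := by
    have := congrArg (fun t => (σ t : ℂ)) hc
    simpa using this
  refine ⟨a, c * (y - a), hda, by linear_combination (-(y - a)) * hc, rfl, ?_⟩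
  simp only [map_mul, map_sub, MulMemClass.coe_mul, AddSubgroupClass.coe_sub, hx]
  linear_combination x * hc'

/-- Residues can be followed inside any window covered by its own contractions. -/
theorem exists_residue_of_covered {σ : cyclotomicIntegers n ≃+* cyclotomicIntegers n} (hn : 0 < n)
    (hb : IsUnit b) {W : Set ℂ}
    (hW : ∀ x ∈ W, ∃ a ∈ polygonAlphabet n, ∃ y ∈ W, x = a + σ b * y)
    (hz : (σ z : ℂ) ∈ W) (k : ℕ) : ∃ y, Residue b z k y ∧ (σ y : ℂ) ∈ W := by
  induction k with
  | zero => exact ⟨z, .zero, hz⟩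
  | succ k ih =>
    obtain ⟨y, hr, hy⟩ := ih
    obtain ⟨a', ha', x, hx, e⟩ := hW _ hy
    obtain ⟨a, y', hda, rfl, -, rfl⟩ := exists_eq_add_mul hn hb ha' e
    exact ⟨y', .succ hr hda, hx⟩

theorem map_ne_zero_of_isUnit (σ : cyclotomicIntegers n ≃+* cyclotomicIntegers n)
    (hb : IsUnit b) : (σ b : ℂ) ≠ 0 := by
  obtain ⟨c, hc⟩ := hb.exists_right_inv
  intro h
  have := congrArg (fun t => (σ t : ℂ)) hc
  simp [h] at this

/-- If points `σ z + t m` lie in the attractor for infinitely many `m`, then the same holds at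
some residue of `z` after rescaling. -/
theorem exists_residue_of_frequently {σ : cyclotomicIntegers n ≃+* cyclotomicIntegers n}
    (hn : 0 < n) (hb : IsUnit b) {t : ℕ → ℂ}
    (hz : ∃ᶠ m in atTop, (σ z : ℂ) + t m ∈ attractorK (σ b) (polygonAlphabet n)) (k : ℕ) :
    ∃ y, Residue b z k y ∧
      ∃ᶠ m in atTop, (σ y : ℂ) + t m / (σ b : ℂ) ^ k ∈ attractorK (σ b) (polygonAlphabet n) := by
  have hγ := map_ne_zero_of_isUnit σ hb
  induction k with
  | zero => exact ⟨z, .zero, by simpa using hz⟩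
  | succ k ih =>
    obtain ⟨y, hr, hy⟩ := ih
    -- Pigeonhole: the alphabet is finite, so one first digit serves infinitely many `m`. Dividing
    -- `y` itself by that digit gives a residue independent of `m`.
    have : ∃ a' ∈ polygonAlphabet n, ∃ᶠ m in atTop, ∃ x ∈ attractorK (σ b : ℂ) (polygonAlphabet n),
        (σ y : ℂ) + t m / (σ b : ℂ) ^ k = a' + σ b * x := by
      by_contra hcon
      push Not at hcon
      refine hy ?_
      filter_upwards [(eventually_all_finite (finite_polygonAlphabet hn)).2 hcon] with m hm hmem
      obtain ⟨a, ha, x, hx, e⟩ := exists_eq_add_mul_of_mem_attractorK hγ hmem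
      exact hm a ha x hx e
    obtain ⟨a', ha', hfr⟩ := this
    obtain ⟨a, y', hda, rfl, ea, ey⟩ := exists_eq_add_mul (σ := σ) (y := y)
      (x := (σ b : ℂ)⁻¹ * (σ y - a')) hn hb ha' (by field_simp; ring)
    refine ⟨y', .succ hr hda, hfr.mono fun m hm => ?_⟩
    obtain ⟨x, hx, e⟩ := hm
    convert hx using 1
    rw [map_add, map_mul] at e
    push_cast at e
    rw [ea] at e
    rw [pow_succ]
    field_simp at e ⊢
    linear_combination e

end Residues

/-! ### Coordinates of cyclotomic integers of degree four -/

/-- The value `v₀ + v₁ x + v₂ x² + v₃ x³`. -/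
def evalQuad {A : Type*} [CommRing A] (x : A) (v : ℤ × ℤ × ℤ × ℤ) : A :=
  v.1 + v.2.1 * x + v.2.2.1 * x ^ 2 + v.2.2.2 * x ^ 3

theorem evalQuad_sub {A : Type*} [CommRing A] (x : A) (v v' : ℤ × ℤ × ℤ × ℤ) :
    evalQuad x (v - v') = evalQuad x v - evalQuad x v' := by
  simp only [evalQuad, Prod.fst_sub, Prod.snd_sub]
  push_cast; ring

/-- Multiplication by x preserves such combinations, because `r` rewrites x⁴. -/
theorem exists_eq_evalQuad {x : ℂ} {r : ℤ × ℤ × ℤ × ℤ} (hx : x ^ 4 = evalQuad x r) {y : ℂ}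
    (hy : y ∈ Algebra.adjoin ℤ {x}) : ∃ v, y = evalQuad x v := by
  rw [Algebra.adjoin_singleton_eq_range_aeval] at hy
  obtain ⟨p, rfl⟩ := hy
  change ∃ v, Polynomial.aeval x p = _
  induction p using Polynomial.induction_on with
  | C a => exact ⟨(a, 0, 0, 0), by simp [evalQuad]⟩
  | add p q hp hq =>
    obtain ⟨v, hv⟩ := hp
    obtain ⟨v', hv'⟩ := hq
    exact ⟨v - (-v'), by rw [map_add, hv, hv']; simp [evalQuad]; ring⟩
  | monomial k a h =>
    obtain ⟨v, hv⟩ := h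
    refine ⟨(v.2.2.2 * r.1, v.1 + v.2.2.2 * r.2.1, v.2.1 + v.2.2.2 * r.2.2.1,
      v.2.2.1 + v.2.2.2 * r.2.2.2), ?_⟩
    rw [pow_succ, ← mul_assoc, map_mul, hv, Polynomial.aeval_X]
    simp only [evalQuad] at hx ⊢
    push_cast
    linear_combination (v.2.2.2 : ℂ) * hx

/-- The generator `ω` as an element of `ℤ[ω]`. -/
noncomputable def genElt (n : ℕ) : cyclotomicIntegers n :=
  ⟨rootOfUnity n, Algebra.subset_adjoin (Set.mem_singleton _)⟩

theorem isPrimitiveRoot_genElt {n : ℕ} (hn : 0 < n) : IsPrimitiveRoot (genElt n) n := by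
  have h := Complex.isPrimitiveRoot_exp n hn.ne'
  have : Function.Injective ((cyclotomicIntegers n).val : cyclotomicIntegers n →* ℂ) :=
    Subtype.val_injective
  exact IsPrimitiveRoot.of_map_of_injective (f := (cyclotomicIntegers n).val) h this

theorem exists_evalQuad_genElt {n : ℕ} {r : ℤ × ℤ × ℤ × ℤ}
    (hr : rootOfUnity n ^ 4 = evalQuad (rootOfUnity n) r) (y : cyclotomicIntegers n) :
    ∃ v, y = evalQuad (genElt n) v := by
  obtain ⟨v, hv⟩ := exists_eq_evalQuad hr y.2
  exact ⟨v, Subtype.ext (by rw [hv]; simp [evalQuad, genElt])⟩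

theorem coe_evalQuad {n : ℕ} (x : cyclotomicIntegers n) (v : ℤ × ℤ × ℤ × ℤ) :
    ((evalQuad x v : cyclotomicIntegers n) : ℂ) = evalQuad (x : ℂ) v := by
  simp [evalQuad]

theorem map_evalQuad {A B : Type*} [CommRing A] [CommRing B] (f : A ≃+* B) (x : A)
    (v : ℤ × ℤ × ℤ × ℤ) : f (evalQuad x v) = evalQuad (f x) v := by
  simp [evalQuad]

theorem conj_mul_self_of_pow_eq_one {n : ℕ} (hn : 0 < n) {x : ℂ} (hx : x ^ n = 1) :
    (starRingEnd ℂ) x * x = 1 := by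
  rw [← Complex.normSq_eq_conj_mul_self, Complex.normSq_eq_norm_sq,
    norm_eq_one_of_pow_eq_one hn hx]
  simp

/-! ### Tenth roots of unity -/

theorem quartic_of_isPrimitiveRoot_ten {A : Type*} [CommRing A] [IsDomain A] {x : A}
    (hx : IsPrimitiveRoot x 10) : x ^ 4 = x ^ 3 - x ^ 2 + x - 1 := by
  have h5 : x ^ 5 ≠ 1 := hx.pow_ne_one_of_pos_of_lt (by norm_num) (by norm_num)
  have h2 : x ^ 2 ≠ 1 := hx.pow_ne_one_of_pos_of_lt (by norm_num) (by norm_num)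
  have h10 := hx.pow_eq_one
  have h5' : x ^ 5 + 1 = 0 := by
    have : (x ^ 5 - 1) * (x ^ 5 + 1) = 0 := by linear_combination h10
    exact (mul_eq_zero.1 this).resolve_left (sub_ne_zero.2 h5)
  have h1 : x + 1 ≠ 0 := fun h => h2 (by linear_combination (x - 1) * h)
  have : (x + 1) * (x ^ 4 - (x ^ 3 - x ^ 2 + x - 1)) = 0 := by linear_combination h5'
  exact sub_eq_zero.1 ((mul_eq_zero.1 this).resolve_left h1)

/-- The integers `p`, `q` with `|z|² = p + q s` at `z = v₀ + v₁ x + v₂ x² + v₃ x³`, for `x` a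
primitive tenth root of unity and `s = x + x⁻¹`. -/
def normPairTen (v : ℤ × ℤ × ℤ × ℤ) : ℤ × ℤ :=
  (v.1 ^ 2 + v.2.1 ^ 2 + v.2.2.1 ^ 2 + v.2.2.2 ^ 2 - v.1 * v.2.2.1 - v.2.1 * v.2.2.2
      + v.1 * v.2.2.2,
    v.1 * v.2.1 + v.2.1 * v.2.2.1 + v.2.2.1 * v.2.2.2 + v.1 * v.2.2.1 + v.2.1 * v.2.2.2
      - v.1 * v.2.2.2)

/-- Complex conjugation sends x to x⁻¹ = -x⁴. The integers do not depend on which primitive root x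
is, so the same pair serves for y and σ(y), with conjugate values of s. -/
theorem norm_evalQuad_sq_ten {x : ℂ} {s : ℝ} (hx : IsPrimitiveRoot x 10) (hs : x - x ^ 4 = s)
    (v : ℤ × ℤ × ℤ × ℤ) :
    ‖evalQuad x v‖ ^ 2 = (normPairTen v).1 + (normPairTen v).2 * s := by
  have h4 := quartic_of_isPrimitiveRoot_ten hx
  have hc := conj_mul_self_of_pow_eq_one (by norm_num) hx.pow_eq_one
  have h5 : x ^ 5 = -1 := by linear_combination (x + 1) * h4
  have hc' : (starRingEnd ℂ) x = -x ^ 4 := by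
    linear_combination (-x ^ 4) * hc + (starRingEnd ℂ) x * h5
  have hreal : ((‖evalQuad x v‖ ^ 2 : ℝ) : ℂ)
      = (((normPairTen v).1 + (normPairTen v).2 * s : ℝ) : ℂ) := by
    rw [← Complex.normSq_eq_norm_sq, Complex.normSq_eq_conj_mul_self]
    have e : (starRingEnd ℂ) (evalQuad x v)
        = v.1 + v.2.1 * (-x ^ 4) + v.2.2.1 * (-x ^ 3) + v.2.2.2 * (-x ^ 2) := by
      simp only [evalQuad, map_add, map_mul, map_pow, hc', map_intCast]
      linear_combination (v.2.2.1 * x ^ 3 - v.2.2.2 * x ^ 2 * (x ^ 5 - 1) : ℂ) * h5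
    rw [e]
    simp only [evalQuad, normPairTen]
    push_cast
    rw [← hs]
    linear_combination
      (-(v.2.1 ^ 2 + v.2.2.1 ^ 2 + v.2.2.2 ^ 2) - (v.2.1 * v.2.2.1 + v.2.2.1 * v.2.2.2) * x
        - v.2.1 * v.2.2.2 * x ^ 2 : ℂ) * h5
      + (v.1 * v.2.2.1 + v.2.1 * v.2.2.2 - v.1 * v.2.2.2 : ℂ) * h4
  exact_mod_cast hreal

/-! ### Eighth roots of unity -/

theorem pow_four_of_isPrimitiveRoot_eight {A : Type*} [CommRing A] [IsDomain A] {x : A}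
    (hx : IsPrimitiveRoot x 8) : x ^ 4 = -1 := by
  have h4 : x ^ 4 ≠ 1 := hx.pow_ne_one_of_pos_of_lt (by norm_num) (by norm_num)
  have : (x ^ 4 - 1) * (x ^ 4 + 1) = 0 := by linear_combination hx.pow_eq_one
  exact eq_neg_of_add_eq_zero_left ((mul_eq_zero.1 this).resolve_left (sub_ne_zero.2 h4))

/-- The integers `p`, `q` with `|z|² = p + q s` at `z = v₀ + v₁ x + v₂ x² + v₃ x³`, for `x` a
primitive eighth root of unity and `s = x + x⁻¹`. -/
def normPairEight (v : ℤ × ℤ × ℤ × ℤ) : ℤ × ℤ :=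
  (v.1 ^ 2 + v.2.1 ^ 2 + v.2.2.1 ^ 2 + v.2.2.2 ^ 2,
    v.1 * v.2.1 + v.2.1 * v.2.2.1 + v.2.2.1 * v.2.2.2 - v.1 * v.2.2.2)

theorem norm_evalQuad_sq_eight {x : ℂ} {s : ℝ} (hx : IsPrimitiveRoot x 8)
    (hs : x - x ^ 3 = s) (v : ℤ × ℤ × ℤ × ℤ) :
    ‖evalQuad x v‖ ^ 2 = (normPairEight v).1 + (normPairEight v).2 * s := by
  have h4 := pow_four_of_isPrimitiveRoot_eight hx
  have hc := conj_mul_self_of_pow_eq_one (by norm_num) hx.pow_eq_one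
  have hc' : (starRingEnd ℂ) x = -x ^ 3 := by
    linear_combination (-x ^ 3) * hc + (starRingEnd ℂ) x * h4
  have hreal : ((‖evalQuad x v‖ ^ 2 : ℝ) : ℂ)
      = (((normPairEight v).1 + (normPairEight v).2 * s : ℝ) : ℂ) := by
    rw [← Complex.normSq_eq_norm_sq, Complex.normSq_eq_conj_mul_self]
    have e : (starRingEnd ℂ) (evalQuad x v)
        = v.1 + v.2.1 * (-x ^ 3) + v.2.2.1 * (-x ^ 2) + v.2.2.2 * (-x) := by
      simp only [evalQuad, map_add, map_mul, map_pow, hc', map_intCast]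
      linear_combination (v.2.2.1 * x ^ 2 - v.2.2.2 * x * (x ^ 4 - 1) : ℂ) * h4
    rw [e]
    simp only [evalQuad, normPairEight]
    push_cast
    rw [← hs]
    linear_combination
      (-(v.2.1 ^ 2 + v.2.2.1 ^ 2 + v.2.2.2 ^ 2) - (v.2.1 * v.2.2.1 + v.2.2.1 * v.2.2.2) * x
        - v.2.1 * v.2.2.2 * x ^ 2 : ℂ) * h4
  exact_mod_cast hreal

/-! ### The silver mean -/

theorem coe_genElt_sub_pow_eight : rootOfUnity 8 - rootOfUnity 8 ^ 3 = (√2 : ℝ) := by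
  have hx : IsPrimitiveRoot (rootOfUnity 8) 8 := Complex.isPrimitiveRoot_exp 8 (by norm_num)
  have h4 := pow_four_of_isPrimitiveRoot_eight hx
  have hc := conj_mul_self_of_pow_eq_one (by norm_num) hx.pow_eq_one
  have hc' : (starRingEnd ℂ) (rootOfUnity 8) = -rootOfUnity 8 ^ 3 := by
    linear_combination (-rootOfUnity 8 ^ 3) * hc + (starRingEnd ℂ) (rootOfUnity 8) * h4
  rw [sub_eq_add_neg, ← hc', Complex.add_conj]
  congr 1
  have : rootOfUnity 8 = Complex.exp ((Real.pi / 4 : ℝ) * Complex.I) := by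
    rw [rootOfUnity]; congr 1; push_cast; ring
  rw [this, Complex.exp_ofReal_mul_I_re, Real.cos_pi_div_four]
  ring

theorem one_lt_silverMean : 1 < silverMean := by
  unfold silverMean
  have : 0 < √2 := by positivity
  linarith

/-- A nonzero late residue would have p² - 2q² = |y|²|σ(y)|² strictly between 0 and 2, and 0 < p <
2. This forces p = 1 and q = 0, hence |y| = 1, too large for a residue. -/
theorem spectrumOf_of_silverMean (h : IsAdmissiblePair 8 silverMean)
    (σ : cyclotomicIntegers 8 ≃+* cyclotomicIntegers 8) (hσ : ‖(σ (baseElt h) : ℂ)‖ < 1)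
    {z : cyclotomicIntegers 8}
    (hz : (σ z : ℂ) ∈ attractorK (σ (baseElt h)) (polygonAlphabet 8)) :
    (z : ℂ) ∈ spectrumOf (polygonAlphabet 8) silverMean := by
  set w := genElt 8 with hw
  have hwp : IsPrimitiveRoot w 8 := isPrimitiveRoot_genElt (by norm_num)
  have hx : IsPrimitiveRoot (rootOfUnity 8) 8 := Complex.isPrimitiveRoot_exp 8 (by norm_num)
  have hηp : IsPrimitiveRoot (σ w : ℂ) 8 := by
    refine IsPrimitiveRoot.map_of_injective (f := (cyclotomicIntegers 8).val) ?_
      Subtype.val_injective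
    exact hwp.map_of_injective σ.injective
  have hη4 := pow_four_of_isPrimitiveRoot_eight hηp
  have hb : baseElt h = 1 + w - w ^ 3 := by
    apply Subtype.ext
    simp only [baseElt, silverMean, hw, genElt]
    push_cast
    rw [← coe_genElt_sub_pow_eight]
    ring
  have hσb : (σ (baseElt h) : ℂ) = 1 + σ w - σ w ^ 3 := by rw [hb]; simp
  have h2 : √2 ^ 2 = 2 := Real.sq_sqrt (by norm_num)
  have h2l : 1.414 < √2 := Real.lt_sqrt_of_sq_lt (by norm_num)
  have h2u : √2 < 1.4143 := by
    rw [Real.sqrt_lt' (by norm_num)]; norm_num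
  -- The left side squares to 2, and the root √2 would make |σ(δ)| exceed 1.
  have hη : (σ w : ℂ) - σ w ^ 3 = (-√2 : ℝ) := by
    have hs : ((σ w : ℂ) - σ w ^ 3 - √2) * ((σ w : ℂ) - σ w ^ 3 + √2) = 0 := by
      have : ((√2 : ℝ) : ℂ) ^ 2 = 2 := by exact_mod_cast h2
      linear_combination (σ w ^ 2 - 2 : ℂ) * hη4 - this
    rcases mul_eq_zero.1 hs with hs | hs
    · exfalso
      have : (σ (baseElt h) : ℂ) = (1 + √2 : ℝ) := by
        push_cast; linear_combination hσb + hs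
      rw [this, Complex.norm_real, Real.norm_of_nonneg (by positivity)] at hσ
      linarith
    · push_cast; linear_combination hs
  have hγ : (σ (baseElt h) : ℂ) = (1 - √2 : ℝ) := by
    push_cast at hη ⊢; linear_combination hσb + hη
  have hγn : ‖(σ (baseElt h) : ℂ)‖ = √2 - 1 := by
    rw [hγ, Complex.norm_real, Real.norm_of_nonpos (by linarith)]; ring
  have hunit : IsUnit (baseElt h) := by
    refine IsUnit.of_mul_eq_one (w - w ^ 3 - 1) ?_
    rw [hb]
    linear_combination (w ^ 2 - 2) * pow_four_of_isPrimitiveRoot_eight hwp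
  have hform : ∀ y : cyclotomicIntegers 8, ∃ p q : ℤ,
      ‖(y : ℂ)‖ ^ 2 = p + q * √2 ∧ ‖(σ y : ℂ)‖ ^ 2 = p - q * √2 := by
    intro y
    obtain ⟨v, rfl⟩ := exists_evalQuad_genElt (n := 8) (r := (-1, 0, 0, 0))
      (by rw [pow_four_of_isPrimitiveRoot_eight hx]; simp [evalQuad]) y
    refine ⟨(normPairEight v).1, (normPairEight v).2, ?_, ?_⟩
    · rw [coe_evalQuad]
      exact norm_evalQuad_sq_eight hx coe_genElt_sub_pow_eight v
    · rw [map_evalQuad, coe_evalQuad, norm_evalQuad_sq_eight hηp hη v]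
      ring
  have hδ : silverMean = 1 + √2 := rfl
  by_contra hcon
  have hbc : (baseElt h : ℂ) = silverMean := rfl
  -- The slack keeps √2/2 + 0.001 below 0.71.
  obtain ⟨k, hk⟩ : ∃ k : ℕ, ‖(z : ℂ)‖ / silverMean ^ k < 0.001 := by
    have : Tendsto (fun k : ℕ => ‖(z : ℂ)‖ / silverMean ^ k) atTop (𝓝 0) :=
      tendsto_const_nhds.div_atTop (tendsto_pow_atTop_atTop_of_one_lt one_lt_silverMean)
    exact (this.eventually (gt_mem_nhds (by norm_num))).exists
  obtain ⟨y, hr, hy⟩ := exists_residue_of_covered (σ := σ) (by norm_num) hunit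
    (fun x hx => exists_eq_add_mul_of_mem_attractorK (map_ne_zero_of_isUnit σ hunit) hx) hz k
  have hy0 : y ≠ 0 := by
    rintro rfl
    exact hr.notMem_spectrumOf (by rwa [hbc])
      (by simpa using zero_mem_spectrumOf (zero_mem_polygonAlphabet 8))
  have n1 := hr.norm_le (by norm_num) one_lt_silverMean hbc
  have n2 := norm_le_of_mem_attractorK
    (fun a => norm_le_one_of_mem_polygonAlphabet (by norm_num)) hσ hy
  have e1 : 1 / (silverMean - 1) = √2 / 2 := by
    rw [hδ, add_sub_cancel_left, div_eq_div_iff (by positivity) (by norm_num)]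
    linarith
  have e2 : (1 - ‖(σ (baseElt h) : ℂ)‖)⁻¹ = 1 + √2 / 2 := by
    rw [hγn, inv_eq_iff_eq_inv, eq_comm]
    exact inv_eq_of_mul_eq_one_right (by linarith)
  rw [e1] at n1
  rw [e2] at n2
  obtain ⟨p, q, hp, hq⟩ := hform y
  have m1 : ‖(y : ℂ)‖ ^ 2 < 0.51 := by
    have : ‖(y : ℂ)‖ < 0.71 := by linarith
    nlinarith [norm_nonneg (y : ℂ)]
  have m2 : ‖(σ y : ℂ)‖ ^ 2 < 2.95 := by
    have : ‖(σ y : ℂ)‖ < 1.71 := by linarith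
    nlinarith [norm_nonneg (σ y : ℂ)]
  have q1 : 0 < ‖(y : ℂ)‖ ^ 2 := by
    have : (y : ℂ) ≠ 0 := fun h => hy0 (Subtype.ext h)
    positivity
  have q2 : 0 < ‖(σ y : ℂ)‖ ^ 2 := by
    have : (σ y : ℂ) ≠ 0 := fun h => hy0 (σ.injective (Subtype.ext (by simpa using h)))
    positivity
  have hpq : (p : ℝ) ^ 2 - 2 * q ^ 2 < 2 ∧ 0 < (p : ℝ) ^ 2 - 2 * q ^ 2 := by
    have : (p : ℝ) ^ 2 - 2 * q ^ 2 = ‖(y : ℂ)‖ ^ 2 * ‖(σ y : ℂ)‖ ^ 2 := by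
      rw [hp, hq]; linear_combination (q : ℝ) ^ 2 * h2
    rw [this]
    exact ⟨by nlinarith, by positivity⟩
  have hp1 : (p : ℝ) < 2 := by linarith
  have hp0 : (0 : ℝ) < p := by linarith
  have hp' : p = 1 := by
    have a1 : p < 2 := by exact_mod_cast hp1
    have a2 : 0 < p := by exact_mod_cast hp0
    omega
  subst hp'
  have hq0 : q = 0 := by
    have : q ^ 2 < 1 := by
      have : (q : ℝ) ^ 2 < 1 := by push_cast at hpq; linarith
      exact_mod_cast this
    nlinarith [sq_nonneg q]
  subst hq0
  push_cast at hp
  linarith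

/-! ### The golden ratio and tenth roots of unity -/

theorem goldenRatio_bounds : 1.618 < Real.goldenRatio ∧ Real.goldenRatio < 1.6181 := by
  have h := Real.goldenRatio_sq
  have h1 := Real.one_lt_goldenRatio
  constructor <;> nlinarith

theorem isPrimitiveRoot_rootOfUnity {n : ℕ} (hn : 0 < n) : IsPrimitiveRoot (rootOfUnity n) n :=
  Complex.isPrimitiveRoot_exp n hn.ne'

theorem isPrimitiveRoot_map_genElt {n : ℕ} (hn : 0 < n)
    (σ : cyclotomicIntegers n ≃+* cyclotomicIntegers n) :
    IsPrimitiveRoot (σ (genElt n) : ℂ) n := by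
  refine IsPrimitiveRoot.map_of_injective (f := (cyclotomicIntegers n).val) ?_
    Subtype.val_injective
  exact (isPrimitiveRoot_genElt hn).map_of_injective σ.injective

theorem pow_five_of_isPrimitiveRoot_ten {A : Type*} [CommRing A] [IsDomain A] {x : A}
    (hx : IsPrimitiveRoot x 10) : x ^ 5 = -1 := by
  linear_combination (x + 1) * quartic_of_isPrimitiveRoot_ten hx

theorem conj_of_isPrimitiveRoot_ten {x : ℂ} (hx : IsPrimitiveRoot x 10) :
    (starRingEnd ℂ) x = -x ^ 4 := by
  have hc := conj_mul_self_of_pow_eq_one (by norm_num) hx.pow_eq_one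
  linear_combination (-x ^ 4) * hc
    + (starRingEnd ℂ) x * pow_five_of_isPrimitiveRoot_ten hx

theorem rootOfUnity_ten_eq_exp :
    rootOfUnity 10 = Complex.exp ((Real.pi / 5 : ℝ) * Complex.I) := by
  rw [rootOfUnity]; congr 1; push_cast; ring

theorem rootOfUnity_ten_sub_pow : rootOfUnity 10 - rootOfUnity 10 ^ 4 = Real.goldenRatio := by
  have hx := isPrimitiveRoot_rootOfUnity (n := 10) (by norm_num)
  rw [sub_eq_add_neg, ← conj_of_isPrimitiveRoot_ten hx, Complex.add_conj]
  congr 1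
  rw [rootOfUnity_ten_eq_exp, Complex.exp_ofReal_mul_I_re, Real.cos_pi_div_five,
    Real.goldenRatio]
  ring

/-- x - x⁴ is a root of t² - t - 1. -/
theorem sub_pow_four_of_isPrimitiveRoot_ten {x : ℂ} (hx : IsPrimitiveRoot x 10) :
    x - x ^ 4 = Real.goldenRatio ∨ x - x ^ 4 = (1 - Real.goldenRatio : ℝ) := by
  have h4 := quartic_of_isPrimitiveRoot_ten hx
  have hφ : (Real.goldenRatio : ℂ) ^ 2 = Real.goldenRatio + 1 := by
    exact_mod_cast Real.goldenRatio_sq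
  have : (x - x ^ 4 - Real.goldenRatio) * (x - x ^ 4 - (1 - Real.goldenRatio)) = 0 := by
    linear_combination (x ^ 3 - 2) * pow_five_of_isPrimitiveRoot_ten hx + h4 - hφ
  rcases mul_eq_zero.1 this with h | h
  · exact Or.inl (sub_eq_zero.1 h)
  · right; rw [Complex.ofReal_sub, Complex.ofReal_one]; exact sub_eq_zero.1 h

theorem exists_norm_sq_ten (σ : cyclotomicIntegers 10 ≃+* cyclotomicIntegers 10)
    (hη : (σ (genElt 10) : ℂ) - σ (genElt 10) ^ 4 = (1 - Real.goldenRatio : ℝ))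
    (y : cyclotomicIntegers 10) : ∃ v, y = evalQuad (genElt 10) v ∧
      ‖(y : ℂ)‖ ^ 2 = (normPairTen v).1 + (normPairTen v).2 * Real.goldenRatio ∧
      ‖(σ y : ℂ)‖ ^ 2 = (normPairTen v).1 + (normPairTen v).2 * (1 - Real.goldenRatio) := by
  have hx := isPrimitiveRoot_rootOfUnity (n := 10) (by norm_num)
  obtain ⟨v, rfl⟩ := exists_evalQuad_genElt (n := 10) (r := (-1, 1, -1, 1))
    (by rw [quartic_of_isPrimitiveRoot_ten hx]; simp [evalQuad]; ring) y
  refine ⟨v, rfl, ?_, ?_⟩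
  · rw [coe_evalQuad]
    exact norm_evalQuad_sq_ten hx rootOfUnity_ten_sub_pow v
  · rw [map_evalQuad, coe_evalQuad]
    exact norm_evalQuad_sq_ten (isPrimitiveRoot_map_genElt (by norm_num) σ) hη v

/-! ### The decagon -/

/-- Twice the real part of `x ω ^ i`, for `ω` the standard tenth root of unity. -/
noncomputable def projTen (i : ℕ) (x : ℂ) : ℝ := 2 * (x * rootOfUnity 10 ^ i).re

/-- The open regular decagon with vertices `τ² ω ^ i`. -/
def decagon : Set ℂ :=
  {x | ∀ i, projTen i x + projTen (i + 1) x < 4 * Real.goldenRatio + 3}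

theorem projTen_add_two (i : ℕ) (x : ℂ) :
    projTen (i + 2) x = Real.goldenRatio * projTen (i + 1) x - projTen i x := by
  have hx := isPrimitiveRoot_rootOfUnity (n := 10) (by norm_num)
  have h5 := pow_five_of_isPrimitiveRoot_ten hx
  have e : x * rootOfUnity 10 ^ (i + 2)
      = (Real.goldenRatio : ℝ) * (x * rootOfUnity 10 ^ (i + 1)) - x * rootOfUnity 10 ^ i := by
    rw [← rootOfUnity_ten_sub_pow]
    linear_combination (x * rootOfUnity 10 ^ i) * h5
  simp only [projTen]
  rw [e, Complex.sub_re, Complex.re_ofReal_mul]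
  ring

theorem projTen_add_five (i : ℕ) (x : ℂ) : projTen (i + 5) x = -projTen i x := by
  have hx := isPrimitiveRoot_rootOfUnity (n := 10) (by norm_num)
  simp only [projTen]
  rw [pow_add, pow_five_of_isPrimitiveRoot_ten hx]
  simp
  ring

theorem projTen_add (i j : ℕ) (x : ℂ) :
    projTen (i + j) x = projTen i (x * rootOfUnity 10 ^ j) := by
  simp only [projTen, pow_add]
  congr 2; ring

theorem projTen_sum_abs_le {x : ℂ} {M : ℝ}
    (h : ∀ i < 5, |projTen i x + projTen (i + 1) x| ≤ M) (i : ℕ) :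
    |projTen i x + projTen (i + 1) x| ≤ M := by
  induction i using Nat.strong_induction_on with
  | _ i ih =>
    by_cases hi : i < 5
    · exact h i hi
    · obtain ⟨j, rfl⟩ := Nat.exists_eq_add_of_le' (not_lt.1 hi)
      rw [show j + 5 + 1 = (j + 1) + 5 by ring, projTen_add_five, projTen_add_five, ← neg_add,
        abs_neg]
      exact ih j (by omega)

theorem mem_decagon_iff {x : ℂ} :
    x ∈ decagon ↔ ∀ i < 5, |projTen i x + projTen (i + 1) x| < 4 * Real.goldenRatio + 3 := by
  constructor
  · intro h i _
    rw [abs_lt]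
    refine ⟨?_, h i⟩
    have := h (i + 5)
    rw [show i + 5 + 1 = (i + 1) + 5 by ring, projTen_add_five, projTen_add_five] at this
    linarith
  · intro h i
    -- `projTen_sum_abs_le` propagates a non-strict bound, so the maximum of the five values stands
    -- in for the strict one.
    obtain ⟨M, hM, hlt⟩ : ∃ M, (∀ i < 5, |projTen i x + projTen (i + 1) x| ≤ M) ∧
        M < 4 * Real.goldenRatio + 3 := by
      refine ⟨(Finset.range 5).sup' (by simp) fun i => |projTen i x + projTen (i + 1) x|,
        fun i hi => Finset.le_sup' (fun i => |projTen i x + projTen (i + 1) x|)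
          (Finset.mem_range.2 hi), ?_⟩
      rw [Finset.sup'_lt_iff]
      exact fun i hi => h i (Finset.mem_range.1 hi)
    exact ((le_abs_self _).trans (projTen_sum_abs_le hM i)).trans_lt hlt

theorem projTen_continuous (i : ℕ) : Continuous (projTen i) := by
  unfold projTen; fun_prop

theorem isOpen_decagon : IsOpen decagon := by
  have : decagon = ⋂ i ∈ Finset.range 5,
      {x | |projTen i x + projTen (i + 1) x| < 4 * Real.goldenRatio + 3} := by
    ext x; simp [mem_decagon_iff]
  rw [this]
  refine isOpen_biInter_finset fun i _ => ?_
  exact isOpen_lt ((projTen_continuous i).add (projTen_continuous (i + 1))).abs continuous_const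

/-- The recurrence `projTen_add_two` expresses all projections through two; antiperiodicity turns
the ten half-planes into five strips. -/
theorem mem_decagon_iff_coords {x : ℂ} {p r : ℝ} (hp : projTen 0 x = p) (hr : projTen 1 x = r) :
    x ∈ decagon ↔
      |p + r| < 4 * Real.goldenRatio + 3 ∧
      |Real.goldenRatio * r + r - p| < 4 * Real.goldenRatio + 3 ∧
      |2 * (Real.goldenRatio * r) - Real.goldenRatio * p - p| < 4 * Real.goldenRatio + 3 ∧
      |Real.goldenRatio * r + r - 2 * (Real.goldenRatio * p)| < 4 * Real.goldenRatio + 3 ∧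
      |r - Real.goldenRatio * p - p| < 4 * Real.goldenRatio + 3 := by
  have h := Real.goldenRatio_sq
  have e2 : projTen 2 x = Real.goldenRatio * r - p := by rw [projTen_add_two, hr, hp]
  have e3 : projTen 3 x = Real.goldenRatio * r - Real.goldenRatio * p := by
    rw [projTen_add_two, e2, hr]; linear_combination r * h
  have e4 : projTen 4 x = r - Real.goldenRatio * p := by
    rw [projTen_add_two, e3, e2]; linear_combination (r - p) * h
  have e5 : projTen 5 x = -p := by rw [← hp, ← projTen_add_five]
  rw [mem_decagon_iff]
  have : (∀ i < 5, |projTen i x + projTen (i + 1) x| < 4 * Real.goldenRatio + 3) ↔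
      |projTen 0 x + projTen 1 x| < 4 * Real.goldenRatio + 3 ∧
      |projTen 1 x + projTen 2 x| < 4 * Real.goldenRatio + 3 ∧
      |projTen 2 x + projTen 3 x| < 4 * Real.goldenRatio + 3 ∧
      |projTen 3 x + projTen 4 x| < 4 * Real.goldenRatio + 3 ∧
      |projTen 4 x + projTen 5 x| < 4 * Real.goldenRatio + 3 := by
    constructor
    · intro h
      exact ⟨h 0 (by norm_num), h 1 (by norm_num), h 2 (by norm_num), h 3 (by norm_num),
        h 4 (by norm_num)⟩
    · rintro ⟨h0, h1, h2, h3, h4⟩ i hi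
      interval_cases i <;> assumption
  rw [this, hp, hr, e2, e3, e4, e5]
  ring_nf

theorem exists_norm_le_of_mem_decagon : ∃ C : ℝ, ∀ x ∈ decagon, ‖x‖ ≤ C := by
  have him : 0 < (rootOfUnity 10).im := by
    rw [rootOfUnity_ten_eq_exp, Complex.exp_ofReal_mul_I_im]
    exact Real.sin_pos_of_pos_of_lt_pi (by positivity) (by linarith [Real.pi_pos])
  obtain ⟨hl, hu⟩ := goldenRatio_bounds
  refine ⟨10 + 20 / (rootOfUnity 10).im, fun x hx => ?_⟩
  obtain ⟨h0, h1, -, -, h4⟩ := (mem_decagon_iff_coords rfl rfl).1 hx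
  rw [abs_lt] at h0 h1 h4
  have hp : |projTen 0 x| ≤ 10 := by rw [abs_le]; constructor <;> nlinarith
  have hr : |projTen 1 x| ≤ 10 := by rw [abs_le]; constructor <;> nlinarith
  have ep : projTen 0 x = 2 * x.re := by simp [projTen]
  have er : projTen 1 x = 2 * (x.re * (rootOfUnity 10).re - x.im * (rootOfUnity 10).im) := by
    simp [projTen]
  have hre : |(rootOfUnity 10).re| ≤ 1 := by
    refine (Complex.abs_re_le_norm _).trans_eq ?_
    exact norm_eq_one_of_pow_eq_one (by norm_num)
      (isPrimitiveRoot_rootOfUnity (n := 10) (by norm_num)).pow_eq_one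
  have hxre : |x.re| ≤ 10 := by
    rw [ep, abs_mul, abs_two] at hp
    have := abs_nonneg x.re
    linarith
  have hxim : |x.im| * (rootOfUnity 10).im ≤ 20 := by
    rw [← abs_of_pos him, ← abs_mul]
    have e : x.im * (rootOfUnity 10).im = x.re * (rootOfUnity 10).re - projTen 1 x / 2 := by
      rw [er]; ring
    rw [e]
    refine (abs_sub _ _).trans ?_
    rw [abs_mul, abs_div, abs_two]
    have := mul_le_mul hxre hre (abs_nonneg _) (by norm_num)
    linarith
  have := Complex.norm_le_abs_re_add_abs_im x
  have h3 := (le_div_iff₀ him).2 hxim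
  linarith

/-- The linear programming behind the covering of the decagon. -/
theorem contracted_bounds {p r : ℝ} (h1 : r ≤ p) (h2 : Real.goldenRatio * p - r ≤ p)
    (h3 : p + r < 4 * Real.goldenRatio + 3)
    (h4 : Real.goldenRatio * p + p - r < 4 * Real.goldenRatio + 3) :
    |-Real.goldenRatio * (p - 2) + -Real.goldenRatio * (r - Real.goldenRatio)|
      < 4 * Real.goldenRatio + 3 ∧
    |Real.goldenRatio * (-Real.goldenRatio * (r - Real.goldenRatio))
        + -Real.goldenRatio * (r - Real.goldenRatio) - -Real.goldenRatio * (p - 2)|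
      < 4 * Real.goldenRatio + 3 ∧
    |2 * (Real.goldenRatio * (-Real.goldenRatio * (r - Real.goldenRatio)))
        - Real.goldenRatio * (-Real.goldenRatio * (p - 2)) - -Real.goldenRatio * (p - 2)|
      < 4 * Real.goldenRatio + 3 ∧
    |Real.goldenRatio * (-Real.goldenRatio * (r - Real.goldenRatio))
        + -Real.goldenRatio * (r - Real.goldenRatio)
        - 2 * (Real.goldenRatio * (-Real.goldenRatio * (p - 2)))|
      < 4 * Real.goldenRatio + 3 ∧
    |-Real.goldenRatio * (r - Real.goldenRatio) - Real.goldenRatio * (-Real.goldenRatio * (p - 2))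
        - -Real.goldenRatio * (p - 2)| < 4 * Real.goldenRatio + 3 := by
  have hφ := Real.goldenRatio_sq
  obtain ⟨hl, hu⟩ := goldenRatio_bounds
  have hpos : 0 < Real.goldenRatio := by linarith
  generalize Real.goldenRatio = φ at *
  -- With φp and φr as new variables and φ² = φ + 1, everything becomes linear in φ, p, r, u, v. The
  -- facts `k1` to `k4` are the hypotheses multiplied by φ.
  obtain ⟨u, hu'⟩ : ∃ u, u = φ * p := ⟨_, rfl⟩
  obtain ⟨v, hv'⟩ : ∃ v, v = φ * r := ⟨_, rfl⟩
  have k1 : v ≤ u := by rw [hu', hv']; exact mul_le_mul_of_nonneg_left h1 hpos.le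
  have k2 : p - v ≤ 0 := by
    have := mul_le_mul_of_nonneg_left h2 hpos.le
    have e : φ * (φ * p - r) = u + p - v := by rw [hu', hv']; linear_combination p * hφ
    rw [e, ← hu'] at this; linarith
  have k3 : u + v < 7 * φ + 4 := by
    have := mul_lt_mul_of_pos_left h3 hpos
    rw [mul_add, ← hu', ← hv'] at this
    linarith
  have k4 : 2 * u + p - v < 7 * φ + 4 := by
    have := mul_lt_mul_of_pos_left h4 hpos
    have e : φ * (φ * p + p - r) = 2 * u + p - v := by rw [hu', hv']; linear_combination p * hφ
    rw [e] at this; linarith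
  have e0 : -φ * (p - 2) = 2 * φ - u := by rw [hu']; ring
  have e1 : -φ * (r - φ) = φ + 1 - v := by rw [hv']; linear_combination hφ
  have e2 : φ * (φ + 1 - v) = 2 * φ + 1 - v - r := by
    rw [hv']; linear_combination (1 - r) * hφ
  have e3 : φ * (2 * φ - u) = 2 * φ + 2 - u - p := by
    rw [hu']; linear_combination (2 - p) * hφ
  rw [← hu'] at h2 h4
  rw [e0, e1, e2, e3]
  clear e0 e1 e2 e3 hu' hv' hφ
  simp only [abs_lt]
  refine ⟨⟨?_, ?_⟩, ⟨?_, ?_⟩, ⟨?_, ?_⟩, ⟨?_, ?_⟩, ?_, ?_⟩ <;> linarith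

/-- The decagon is covered by its ten contractions towards the vertices. -/
theorem exists_eq_add_mul_of_mem_decagon {x : ℂ} (hx : x ∈ decagon) :
    ∃ a ∈ polygonAlphabet 10, ∃ y ∈ decagon, x = a + (1 - Real.goldenRatio : ℝ) * y := by
  have hω := isPrimitiveRoot_rootOfUnity (n := 10) (by norm_num)
  have h5 := pow_five_of_isPrimitiveRoot_ten hω
  have h10 := hω.pow_eq_one
  have hφ := Real.goldenRatio_sq
  obtain ⟨hl, hu⟩ := goldenRatio_bounds
  have hper : ∀ i, projTen (i + 10) x = projTen i x := fun i => by
    rw [show i + 10 = (i + 5) + 5 by ring, projTen_add_five, projTen_add_five, neg_neg]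
  -- Maximality puts y = xω^k in the sector around the vertex on the positive axis, so the digit for
  -- x is ω^(-k) = ω^(10-k). Only the two neighbouring inequalities matter; k + 9 stands for k - 1.
  obtain ⟨k, hk, hmax⟩ : ∃ k < 10, ∀ j < 10, projTen j x ≤ projTen k x := by
    obtain ⟨k, hk, h⟩ := Finset.exists_max_image (Finset.range 10) (fun i => projTen i x)
      (by simp)
    exact ⟨k, Finset.mem_range.1 hk, fun j hj => h j (Finset.mem_range.2 hj)⟩
  have hmax1 : projTen (k + 1) x ≤ projTen k x := by
    rcases (by omega : k + 1 < 10 ∨ k = 9) with h | rfl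
    · exact hmax _ h
    · rw [show 9 + 1 = 0 + 10 by norm_num, hper]; exact hmax _ (by norm_num)
  have hmax9 : projTen (k + 9) x ≤ projTen k x := by
    rcases (⟨k - 1, by omega⟩ : ∃ m, k = 0 ∨ k = m + 1 ∧ m < 10) with ⟨m, rfl | ⟨rfl, hm⟩⟩
    · exact hmax _ (by norm_num)
    · rw [show m + 1 + 9 = m + 10 by ring, hper]; exact hmax _ hm
  set y := x * rootOfUnity 10 ^ k with hy
  set p := projTen 0 y with hp
  set r := projTen 1 y with hr
  have ek : projTen k x = p := by rw [hp, hy, ← projTen_add, zero_add]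
  have ek1 : projTen (k + 1) x = r := by rw [hr, hy, ← projTen_add, add_comm]
  have ek9 : projTen (k + 9) x = Real.goldenRatio * p - r := by
    have := projTen_add_two (k + 9) x
    rw [show k + 9 + 2 = k + 1 + 10 by ring, show k + 9 + 1 = k + 10 by ring, hper, hper, ek,
      ek1] at this
    linarith
  rw [ek1, ek] at hmax1
  rw [ek9, ek] at hmax9
  have hyd : y ∈ decagon := by
    intro i
    have := hx (i + k)
    rwa [show i + k + 1 = (i + 1) + k by ring, projTen_add, projTen_add] at this
  obtain ⟨h0, -, -, -, h4⟩ := (mem_decagon_iff_coords hp.symm hr.symm).1 hyd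
  have h0 := (abs_lt.1 h0).2
  have h4 := (abs_lt.1 h4).1
  -- The inverse of 1 - τ is -τ.
  refine ⟨rootOfUnity 10 ^ (10 - k), Or.inl ⟨(10 - k : ℕ), zpow_natCast _ _⟩,
    -(Real.goldenRatio : ℂ) * (x - rootOfUnity 10 ^ (10 - k)), ?_, ?_⟩
  swap
  · have : (Real.goldenRatio : ℂ) ^ 2 = Real.goldenRatio + 1 := by exact_mod_cast hφ
    rw [Complex.ofReal_sub, Complex.ofReal_one]
    linear_combination (-(x - rootOfUnity 10 ^ (10 - k))) * this
  have hsuff : -(Real.goldenRatio : ℂ) * (y - 1) ∈ decagon := by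
    have e0 : projTen 0 (-(Real.goldenRatio : ℂ) * (y - 1)) = -Real.goldenRatio * (p - 2) := by
      rw [hp]
      simp only [projTen]
      rw [pow_zero, mul_one, mul_one, ← Complex.ofReal_neg, Complex.re_ofReal_mul]
      simp; ring
    have e1 : projTen 1 (-(Real.goldenRatio : ℂ) * (y - 1))
        = -Real.goldenRatio * (r - Real.goldenRatio) := by
      have hre : (2 : ℝ) * (rootOfUnity 10).re = Real.goldenRatio := by
        rw [rootOfUnity_ten_eq_exp, Complex.exp_ofReal_mul_I_re, Real.cos_pi_div_five,
          Real.goldenRatio]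
        ring
      rw [← hre, hr]
      simp only [projTen]
      rw [hre, ← Complex.ofReal_neg, mul_assoc, Complex.re_ofReal_mul, sub_mul, one_mul,
        Complex.sub_re, pow_one, ← hre]
      ring
    rw [mem_decagon_iff_coords e0 e1]
    exact contracted_bounds hmax1 hmax9 h0 (by linarith)
  intro i
  have := hsuff (i + (10 - k))
  have e : -(Real.goldenRatio : ℂ) * (y - 1) * rootOfUnity 10 ^ (10 - k)
      = -(Real.goldenRatio : ℂ) * (x - rootOfUnity 10 ^ (10 - k)) := by
    have : rootOfUnity 10 ^ k * rootOfUnity 10 ^ (10 - k) = 1 := by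
      rw [← pow_add, Nat.add_sub_cancel' hk.le, h10]
    rw [hy]
    linear_combination (-(Real.goldenRatio : ℂ) * x) * this
  rwa [show i + (10 - k) + 1 = (i + 1) + (10 - k) by ring, projTen_add, projTen_add, e] at this

/-! ### The golden mean -/

/-- Digits satisfy the support bound of the decagon with unit vertices. -/
theorem projTen_digit_abs_le {a : ℂ} (ha : a ∈ polygonAlphabet 10) (i : ℕ) :
    |projTen i a + projTen (i + 1) a| ≤ 2 + Real.goldenRatio := by
  obtain ⟨hl, hu⟩ := goldenRatio_bounds
  have hφ := Real.goldenRatio_sq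
  rcases (mem_polygonAlphabet_iff (by norm_num)).1 ha with rfl | ha
  · simp only [projTen, zero_mul, Complex.zero_re]
    norm_num; linarith
  · obtain ⟨j, -, rfl⟩ :=
      (isPrimitiveRoot_rootOfUnity (n := 10) (by norm_num)).eq_pow_of_pow_eq_one ha
    have hshift : ∀ i, projTen i (rootOfUnity 10 ^ j) = projTen (i + j) 1 := fun i => by
      rw [projTen_add, one_mul]
    rw [hshift, hshift, show i + 1 + j = i + j + 1 by ring]
    have e0 : projTen 0 1 = 2 := by simp [projTen]
    have e1 : projTen 1 1 = Real.goldenRatio := by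
      simp only [projTen, one_mul, pow_one]
      rw [rootOfUnity_ten_eq_exp, Complex.exp_ofReal_mul_I_re, Real.cos_pi_div_five,
        Real.goldenRatio]
      ring
    have e2 : projTen 2 1 = Real.goldenRatio - 1 := by
      rw [projTen_add_two, e0, e1]; linear_combination hφ
    have e3 : projTen 3 1 = 1 - Real.goldenRatio := by
      rw [projTen_add_two, e1, e2]; linear_combination hφ
    have e4 : projTen 4 1 = -Real.goldenRatio := by
      rw [projTen_add_two, e2, e3]; linear_combination -hφ
    have e5 : projTen 5 1 = -2 := by rw [← e0, ← projTen_add_five]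
    refine projTen_sum_abs_le (fun i hi => ?_) _
    rw [abs_le]
    interval_cases i <;> norm_num [e0, e1, e2, e3, e4, e5] <;> (try constructor) <;> linarith

/-- The digit bound 2 + τ is summed against a geometric series of ratio τ - 1: (2 + τ)/(2 - τ) = 4τ
+ 3. -/
theorem projTen_sum_le_of_mem_attractorK {x : ℂ}
    (hx : x ∈ attractorK (1 - Real.goldenRatio : ℝ) (polygonAlphabet 10)) (i : ℕ) :
    projTen i x + projTen (i + 1) x ≤ 4 * Real.goldenRatio + 3 := by
  obtain ⟨hl, hu⟩ := goldenRatio_bounds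
  have hφ := Real.goldenRatio_sq
  obtain ⟨c, hc, hs⟩ := hx
  have hs' : HasSum (fun k => (projTen i (c k) + projTen (i + 1) (c k))
      * (1 - Real.goldenRatio) ^ k) (projTen i x + projTen (i + 1) x) := by
    have h1 := (Complex.hasSum_re (hs.mul_right (rootOfUnity 10 ^ i))).mul_left 2
    have h2 := (Complex.hasSum_re (hs.mul_right (rootOfUnity 10 ^ (i + 1)))).mul_left 2
    have e : (fun k => (projTen i (c k) + projTen (i + 1) (c k)) * (1 - Real.goldenRatio) ^ k)
        = fun k => 2 * (c k * ((1 - Real.goldenRatio : ℝ) : ℂ) ^ k * rootOfUnity 10 ^ i).re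
          + 2 * (c k * ((1 - Real.goldenRatio : ℝ) : ℂ) ^ k * rootOfUnity 10 ^ (i + 1)).re := by
      funext k
      rw [← Complex.ofReal_pow, mul_comm (c k), mul_assoc, mul_assoc, Complex.re_ofReal_mul,
        Complex.re_ofReal_mul, projTen, projTen]
      ring
    rw [e]
    exact h1.add h2
  have hg : HasSum (fun k => (2 + Real.goldenRatio) * (Real.goldenRatio - 1) ^ k)
      (4 * Real.goldenRatio + 3) := by
    have := (hasSum_geometric_of_lt_one (r := Real.goldenRatio - 1) (by linarith)
      (by linarith)).mul_left (2 + Real.goldenRatio)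
    have e : (2 + Real.goldenRatio) * (1 - (Real.goldenRatio - 1))⁻¹
        = 4 * Real.goldenRatio + 3 := by
      rw [← div_eq_mul_inv, div_eq_iff (by linarith)]
      linear_combination 4 * hφ
    rwa [e] at this
  refine hasSum_le (fun k => ?_) hs' hg
  refine (le_abs_self _).trans ?_
  rw [abs_mul, abs_pow, abs_sub_comm, abs_of_pos (by linarith : 0 < Real.goldenRatio - 1)]
  exact mul_le_mul_of_nonneg_right (projTen_digit_abs_le (hc k) i)
    (pow_nonneg (by linarith) _)

theorem projTen_sum_eq (i : ℕ) (x : ℂ) : projTen i x + projTen (i + 1) x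
    = 2 * (x * (rootOfUnity 10 ^ i * (1 + rootOfUnity 10))).re := by
  simp only [projTen]
  rw [← mul_add, ← Complex.add_re]
  congr 2; ring

/-- The non-strict inequalities hold on K. An interior point can be moved slightly along the outer
normal, the conjugate of `c`, without leaving K, so its inequality is strict. -/
theorem interior_attractorK_subset_decagon :
    interior (attractorK (1 - Real.goldenRatio : ℝ) (polygonAlphabet 10)) ⊆ decagon := by
  intro x hx i
  set c := rootOfUnity 10 ^ i * (1 + rootOfUnity 10) with hc
  have hω := isPrimitiveRoot_rootOfUnity (n := 10) (by norm_num)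
  have hc0 : c ≠ 0 := by
    refine mul_ne_zero (pow_ne_zero _ (hω.ne_zero (by norm_num))) fun h => ?_
    refine hω.pow_ne_one_of_pos_of_lt (l := 2) (by norm_num) (by norm_num) ?_
    linear_combination (rootOfUnity 10 - 1) * h
  have ht : Tendsto (fun t : ℝ => x + t * (starRingEnd ℂ) c) (𝓝[>] 0) (𝓝 x) := by
    have : Continuous fun t : ℝ => x + t * (starRingEnd ℂ) c := by fun_prop
    simpa using (this.tendsto 0).mono_left nhdsWithin_le_nhds
  obtain ⟨t, hmem, ht0⟩ := ((ht.eventually (mem_interior_iff_mem_nhds.1 hx)).and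
    self_mem_nhdsWithin).exists
  have hle := projTen_sum_le_of_mem_attractorK hmem i
  rw [projTen_sum_eq, ← hc] at hle ⊢
  have e : (x + t * (starRingEnd ℂ) c) * c = x * c + (t * Complex.normSq c : ℝ) := by
    rw [Complex.ofReal_mul, Complex.normSq_eq_conj_mul_self]; ring
  rw [e, Complex.add_re, Complex.ofReal_re] at hle
  have : 0 < t * Complex.normSq c := mul_pos ht0 (Complex.normSq_pos.2 hc0)
  linarith

theorem decagon_subset_interior_attractorK :
    decagon ⊆ interior (attractorK (1 - Real.goldenRatio : ℝ) (polygonAlphabet 10)) := by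
  obtain ⟨C, hC⟩ := exists_norm_le_of_mem_decagon
  obtain ⟨hl, hu⟩ := goldenRatio_bounds
  refine interior_maximal (subset_attractorK_of_covered ?_ hC
    (fun a => norm_le_one_of_mem_polygonAlphabet (by norm_num))
    fun x => exists_eq_add_mul_of_mem_decagon) isOpen_decagon
  rw [Complex.norm_real, Real.norm_of_nonpos (by linarith)]
  linarith

/-- The values `|y|²` of cyclotomic integers with bounded conjugates are discrete. -/
theorem exists_finite_norm_sq (σ : cyclotomicIntegers 10 ≃+* cyclotomicIntegers 10)
    (hη : (σ (genElt 10) : ℂ) - σ (genElt 10) ^ 4 = (1 - Real.goldenRatio : ℝ)) (V C : ℝ) :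
    {v : ℝ | ∃ y : cyclotomicIntegers 10, ‖(y : ℂ)‖ ^ 2 = v ∧ v ≤ V ∧
      ‖(σ y : ℂ)‖ ^ 2 ≤ C}.Finite := by
  obtain ⟨hl, hu⟩ := goldenRatio_bounds
  -- Subtracting the conjugate values p + qτ and p + q(1-τ) isolates q√5, whence |q| ≤ V + C and |p|
  -- ≤ V + 2(V + C).
  obtain ⟨N, hN⟩ := exists_nat_ge (3 * V + 2 * C)
  refine (((Set.finite_Icc (-N : ℤ) N).prod (Set.finite_Icc (-N : ℤ) N)).image
    fun pq : ℤ × ℤ => (pq.1 + pq.2 * Real.goldenRatio : ℝ)).subset ?_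
  rintro v ⟨y, rfl, hV, hC⟩
  obtain ⟨w, -, h1, h2⟩ := exists_norm_sq_ten σ hη y
  refine ⟨normPairTen w, ?_, h1.symm⟩
  rw [h1] at hV
  rw [h2] at hC
  have i1 := sq_nonneg ‖(y : ℂ)‖
  have i2 := sq_nonneg ‖(σ y : ℂ)‖
  rw [h1] at i1
  rw [h2] at i2
  generalize (normPairTen w) = pq at *
  have hq : |(pq.2 : ℝ)| ≤ V + C := by
    rw [abs_le]; constructor
    · by_contra hcon
      nlinarith
    · by_contra hcon
      nlinarith
  have hp : |(pq.1 : ℝ)| ≤ V + 2 * (V + C) := by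
    rw [abs_le] at hq ⊢; constructor <;> nlinarith
  have key : ∀ m : ℤ, |(m : ℝ)| ≤ N → m ∈ Set.Icc (-N : ℤ) N := fun m hm => by
    rw [abs_le] at hm
    exact ⟨by exact_mod_cast hm.1, by exact_mod_cast hm.2⟩
  exact ⟨key _ (by linarith), key _ (by linarith [abs_nonneg (pq.2 : ℝ)])⟩

theorem spectrumOf_of_goldenRatio (h : IsAdmissiblePair 10 Real.goldenRatio)
    (σ : cyclotomicIntegers 10 ≃+* cyclotomicIntegers 10) (hσ : ‖(σ (baseElt h) : ℂ)‖ < 1)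
    (hball : ∀ y : cyclotomicIntegers 10,
      (σ y : ℂ) ∈ interior (attractorK (σ (baseElt h)) (polygonAlphabet 10)) →
      ‖(y : ℂ)‖ ≤ 1 / (Real.goldenRatio - 1) →
      (y : ℂ) ∈ spectrumOf (polygonAlphabet 10) Real.goldenRatio)
    {z : cyclotomicIntegers 10}
    (hz : (σ z : ℂ) ∈ interior (attractorK (σ (baseElt h)) (polygonAlphabet 10))) :
    (z : ℂ) ∈ spectrumOf (polygonAlphabet 10) Real.goldenRatio := by
  obtain ⟨hl, hu⟩ := goldenRatio_bounds
  have hwp : IsPrimitiveRoot (genElt 10) 10 := isPrimitiveRoot_genElt (by norm_num)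
  have hb : baseElt h = genElt 10 - genElt 10 ^ 4 :=
    Subtype.ext rootOfUnity_ten_sub_pow.symm
  have hσb : (σ (baseElt h) : ℂ) = σ (genElt 10) - σ (genElt 10) ^ 4 := by rw [hb]; simp
  have hη : (σ (genElt 10) : ℂ) - σ (genElt 10) ^ 4 = (1 - Real.goldenRatio : ℝ) := by
    refine (sub_pow_four_of_isPrimitiveRoot_ten
      (isPrimitiveRoot_map_genElt (by norm_num) σ)).resolve_left fun hcon => ?_
    rw [hσb, hcon, Complex.norm_real, Real.norm_of_nonneg (by linarith)] at hσ
    linarith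
  rw [hη] at hσb
  rw [hσb] at hball hz
  have hunit : IsUnit (baseElt h) := by
    refine IsUnit.of_mul_eq_one (genElt 10 - genElt 10 ^ 4 - 1) ?_
    rw [hb]
    linear_combination (genElt 10 ^ 3 - 2) * pow_five_of_isPrimitiveRoot_ten hwp
      + quartic_of_isPrimitiveRoot_ten hwp
  have hbc : (baseElt h : ℂ) = Real.goldenRatio := rfl
  have hβ := Real.one_lt_goldenRatio
  obtain ⟨C, hC⟩ := exists_norm_le_of_mem_decagon
  have htend : Tendsto (fun k : ℕ => (‖(z : ℂ)‖ / Real.goldenRatio ^ k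
      + 1 / (Real.goldenRatio - 1)) ^ 2) atTop (𝓝 ((1 / (Real.goldenRatio - 1)) ^ 2)) := by
    have : Tendsto (fun k : ℕ => ‖(z : ℂ)‖ / Real.goldenRatio ^ k) atTop (𝓝 0) :=
      tendsto_const_nhds.div_atTop (tendsto_pow_atTop_atTop_of_one_lt hβ)
    simpa using (this.add_const (1 / (Real.goldenRatio - 1))).pow 2
  -- Only finitely many values |y|² are possible, so for large k the residue bound lies below each
  -- one exceeding the squared radius of the ball. This moves the residue into the closed ball.
  have hev : ∀ᶠ k : ℕ in atTop, ∀ v ∈ {v : ℝ | ∃ y : cyclotomicIntegers 10, ‖(y : ℂ)‖ ^ 2 = v ∧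
      v ≤ (1 / (Real.goldenRatio - 1)) ^ 2 + 1 ∧ ‖(σ y : ℂ)‖ ^ 2 ≤ C ^ 2},
      (1 / (Real.goldenRatio - 1)) ^ 2 < v →
      (‖(z : ℂ)‖ / Real.goldenRatio ^ k + 1 / (Real.goldenRatio - 1)) ^ 2 < v := by
    refine (eventually_all_finite (exists_finite_norm_sq σ hη _ _)).2 fun v _ => ?_
    by_cases hv : (1 / (Real.goldenRatio - 1)) ^ 2 < v
    · filter_upwards [htend.eventually (gt_mem_nhds hv)] with k hk _ using hk
    · exact Eventually.of_forall fun k hk => absurd hk hv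
  have hev1 := htend.eventually (gt_mem_nhds (lt_add_one _))
  obtain ⟨k, hk, hk1⟩ := (hev.and hev1).exists
  obtain ⟨y, hr, hy⟩ := exists_residue_of_covered (σ := σ) (by norm_num) hunit
    (W := decagon) (fun x hx => by rw [hσb]; exact exists_eq_add_mul_of_mem_decagon hx)
    (interior_attractorK_subset_decagon hz) k
  by_contra hcon
  refine hr.notMem_spectrumOf (by rwa [hbc]) ?_
  rw [hbc]
  refine hball y (decagon_subset_interior_attractorK hy) ?_
  have hle := pow_le_pow_left₀ (norm_nonneg _) (hr.norm_le (by norm_num) hβ hbc) 2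
  by_contra hgt
  rw [not_le] at hgt
  have hpos : 0 < 1 / (Real.goldenRatio - 1) := by
    have : 0 < Real.goldenRatio - 1 := by linarith
    positivity
  have := hk _ ⟨y, rfl, hle.trans hk1.le, pow_le_pow_left₀ (norm_nonneg _) (hC _ hy) 2⟩
    (pow_lt_pow_left₀ hgt hpos.le (by norm_num))
  linarith

/-! ### The square of the golden mean -/

/-- The golden mean as an element of `ℤ[ω]`. -/
noncomputable def goldenElt : cyclotomicIntegers 10 := genElt 10 - genElt 10 ^ 4

theorem coe_goldenElt : (goldenElt : ℂ) = Real.goldenRatio := rootOfUnity_ten_sub_pow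

theorem goldenElt_sq : goldenElt ^ 2 = goldenElt + 1 := by
  apply Subtype.ext
  push_cast
  rw [coe_goldenElt]
  exact_mod_cast Real.goldenRatio_sq

theorem eq_unit_of_normPairTen {v : ℤ × ℤ × ℤ × ℤ} (h : normPairTen v = (1, 0)) :
    evalQuad (genElt 10) v ^ 10 = 1 := by
  obtain ⟨a, b, c, d⟩ := v
  simp only [normPairTen, Prod.mk.injEq] at h
  obtain ⟨h1, h2⟩ := h
  -- This positive definite form is 4p + 2q, twice |y|² + |σ(y)|². It bounds the coordinates and
  -- leaves a finite search, whose solutions are ±ω^i for i ≤ 4.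
  have hform : a ^ 2 + b ^ 2 + c ^ 2 + d ^ 2 + (a + b) ^ 2 + (a - c) ^ 2 + (a + d) ^ 2
      + (b + c) ^ 2 + (b - d) ^ 2 + (c + d) ^ 2 = 4 := by linear_combination 4 * h1 + 2 * h2
  have hle : ∀ m : ℤ, m ^ 2 ≤ 4 → m ∈ Finset.Icc (-2 : ℤ) 2 := fun m hm => by
    rw [Finset.mem_Icc]; constructor <;> nlinarith
  have ha := hle a (by nlinarith)
  have hb := hle b (by nlinarith)
  have hc := hle c (by nlinarith)
  have hd := hle d (by nlinarith)
  clear h1 h2 hle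
  have key : ∀ a ∈ Finset.Icc (-2 : ℤ) 2, ∀ b ∈ Finset.Icc (-2 : ℤ) 2,
      ∀ c ∈ Finset.Icc (-2 : ℤ) 2, ∀ d ∈ Finset.Icc (-2 : ℤ) 2,
      a ^ 2 + b ^ 2 + c ^ 2 + d ^ 2 + (a + b) ^ 2 + (a - c) ^ 2 + (a + d) ^ 2
      + (b + c) ^ 2 + (b - d) ^ 2 + (c + d) ^ 2 = 4 →
      ∃ s ∈ ({1, -1} : Finset ℤ), (a, b, c, d) ∈ ({(s, 0, 0, 0), (0, s, 0, 0), (0, 0, s, 0),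
        (0, 0, 0, s), (-s, s, -s, s)} : Finset (ℤ × ℤ × ℤ × ℤ)) := by
    decide +kernel
  obtain ⟨s, hs, hmem⟩ := key a ha b hb c hc d hd hform
  have h10 := (isPrimitiveRoot_genElt (n := 10) (by norm_num)).pow_eq_one
  have h4 := quartic_of_isPrimitiveRoot_ten (isPrimitiveRoot_genElt (n := 10) (by norm_num))
  have hs10 : (s : cyclotomicIntegers 10) ^ 10 = 1 := by
    simp only [Finset.mem_insert, Finset.mem_singleton] at hs
    rcases hs with rfl | rfl <;> norm_num
  have hpow : ∀ i : ℕ, ((s : cyclotomicIntegers 10) * genElt 10 ^ i) ^ 10 = 1 := fun i => by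
    rw [mul_pow, hs10, ← pow_mul, mul_comm i, pow_mul, h10, one_pow, one_mul]
  simp only [Finset.mem_insert, Finset.mem_singleton, Prod.mk.injEq] at hmem
  rcases hmem with ⟨rfl, rfl, rfl, rfl⟩ | ⟨rfl, rfl, rfl, rfl⟩ | ⟨rfl, rfl, rfl, rfl⟩ |
    ⟨rfl, rfl, rfl, rfl⟩ | ⟨rfl, rfl, rfl, rfl⟩
  · simpa [evalQuad] using hpow 0
  · simpa [evalQuad] using hpow 1
  · simpa [evalQuad] using hpow 2
  · simpa [evalQuad] using hpow 3
  · rw [← hpow 4, h4]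
    simp only [evalQuad]
    push_cast
    ring

/-- The only cyclotomic integers close to the ball of radius `1 / τ` whose conjugates lie in the
disc of radius `τ` are `0` and the tenth roots of unity divided by `τ`. -/
theorem eq_zero_or_eq_of_norm_le (σ : cyclotomicIntegers 10 ≃+* cyclotomicIntegers 10)
    (hη : (σ (genElt 10) : ℂ) - σ (genElt 10) ^ 4 = (1 - Real.goldenRatio : ℝ))
    {y : cyclotomicIntegers 10} (h1 : ‖(y : ℂ)‖ < 0.6185)
    (h2 : ‖(σ y : ℂ)‖ ≤ Real.goldenRatio) :
    y = 0 ∨ ∃ u : cyclotomicIntegers 10, u ^ 10 = 1 ∧ y = (1 - goldenElt) * u := by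
  obtain ⟨hl, hu⟩ := goldenRatio_bounds
  have hφ := Real.goldenRatio_sq
  by_cases hy0 : y = 0
  · exact Or.inl hy0
  right
  have hσg : (σ goldenElt : ℂ) = (1 - Real.goldenRatio : ℝ) := by
    rw [← hη]; simp [goldenElt]
  -- Multiplication by τ rescales both bounds to about 1. The norm p² + pq - q² is then a positive
  -- integer below 2, so both squared moduli are close to 1, giving q = 0 and p = 1.
  obtain ⟨v, hv, e1, e2⟩ := exists_norm_sq_ten σ hη (goldenElt * y)
  have n1 : ‖((goldenElt * y : cyclotomicIntegers 10) : ℂ)‖ = Real.goldenRatio * ‖(y : ℂ)‖ := by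
    push_cast
    rw [norm_mul, coe_goldenElt, Complex.norm_real, Real.norm_of_nonneg (by linarith)]
  have n2 : ‖(σ (goldenElt * y) : ℂ)‖ = (Real.goldenRatio - 1) * ‖(σ y : ℂ)‖ := by
    rw [map_mul, MulMemClass.coe_mul, norm_mul, hσg, Complex.norm_real,
      Real.norm_of_nonpos (by linarith)]
    ring
  have p1 : 0 < ‖(y : ℂ)‖ := norm_pos_iff.2 fun h => hy0 (Subtype.ext h)
  have p2 : 0 < ‖(σ y : ℂ)‖ :=
    norm_pos_iff.2 fun h => hy0 (σ.injective (Subtype.ext (by simpa using h)))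
  rw [n1] at e1
  rw [n2] at e2
  have A1 : Real.goldenRatio * ‖(y : ℂ)‖ < 1.002 := by nlinarith
  have A0 : 0 < Real.goldenRatio * ‖(y : ℂ)‖ := by positivity
  have B1 : (Real.goldenRatio - 1) * ‖(σ y : ℂ)‖ ≤ 1 := by nlinarith
  have B0 : 0 < (Real.goldenRatio - 1) * ‖(σ y : ℂ)‖ := mul_pos (by linarith) p2
  generalize Real.goldenRatio * ‖(y : ℂ)‖ = A at *
  generalize (Real.goldenRatio - 1) * ‖(σ y : ℂ)‖ = B at *
  have hvpq : normPairTen v = (1, 0) := by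
    generalize normPairTen v = pq at *
    obtain ⟨p, q⟩ := pq
    simp only at e1 e2
    have hA2 : A ^ 2 < 1.005 := by nlinarith
    have hB2 : B ^ 2 ≤ 1 := by nlinarith
    have hprod : ((p ^ 2 + p * q - q ^ 2 : ℤ) : ℝ) = A ^ 2 * B ^ 2 := by
      rw [e1, e2]; push_cast; linear_combination (q : ℝ) ^ 2 * hφ
    have hN : p ^ 2 + p * q - q ^ 2 = 1 := by
      have l1 : (0 : ℝ) < ((p ^ 2 + p * q - q ^ 2 : ℤ) : ℝ) := by rw [hprod]; positivity
      have l2 : ((p ^ 2 + p * q - q ^ 2 : ℤ) : ℝ) < (2 : ℤ) := by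
        rw [hprod]; push_cast; nlinarith [sq_nonneg A, sq_nonneg B]
      have l1' : 0 < p ^ 2 + p * q - q ^ 2 := by exact_mod_cast l1
      have l2' := Int.cast_lt.1 l2
      omega
    rw [hN] at hprod
    push_cast at hprod
    have hB2' : 0.99 < B ^ 2 := by nlinarith
    have hA2' : 0.99 < A ^ 2 := by nlinarith
    have hq : q = 0 := by
      have hd : (q : ℝ) * (2 * Real.goldenRatio - 1) = A ^ 2 - B ^ 2 := by rw [e1, e2]; ring
      have g1 : (q : ℝ) < 1 := by nlinarith
      have g2 : (-1 : ℝ) < q := by nlinarith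
      have g1' : q < 1 := by exact_mod_cast g1
      have g2' : -1 < q := by exact_mod_cast g2
      omega
    subst hq
    have hp : p = 1 := by
      push_cast at e1
      have g1 : (p : ℝ) < 2 := by linarith
      have g2 : (0 : ℝ) < p := by linarith
      have g1' : p < 2 := by exact_mod_cast g1
      have g2' : 0 < p := by exact_mod_cast g2
      omega
    rw [hp]
  refine ⟨-(goldenElt * y), ?_, ?_⟩
  · rw [hv, Even.neg_pow (by decide)]
    exact eq_unit_of_normPairTen hvpq
  · linear_combination (-y) * goldenElt_sq

/-! #### Backward steps from the vertices -/

theorem isDigit_root_mul_pow {u : cyclotomicIntegers 10} (hu : u ^ 10 = 1) (i : ℕ) :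
    IsDigit (u * genElt 10 ^ i) := by
  rw [isDigit_iff (by norm_num)]
  right
  rw [mul_pow, hu, ← pow_mul, mul_comm i, pow_mul,
    (isPrimitiveRoot_genElt (n := 10) (by norm_num)).pow_eq_one, one_pow, one_mul]

theorem exists_eq_mul_pow {u a : cyclotomicIntegers 10} (hu : u ^ 10 = 1) (ha : a ^ 10 = 1) :
    ∃ i < 10, a = u * genElt 10 ^ i := by
  have : (u ^ 9 * a) ^ 10 = 1 := by
    rw [mul_pow, ha, ← pow_mul, mul_comm 9, pow_mul, hu]; simp
  obtain ⟨i, hi, e⟩ :=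
    (isPrimitiveRoot_genElt (n := 10) (by norm_num)).eq_pow_of_pow_eq_one this
  exact ⟨i, hi, by rw [e]; linear_combination (-a) * hu⟩

/-- A predecessor `b v + a` of the vertex `v = -u / τ` lies in the spectrum unless
`a` is one of three digits. -/
theorem digit_of_notMem_spectrumOf {b u a : cyclotomicIntegers 10} (hb : b = goldenElt ^ 2)
    (hu : u ^ 10 = 1) (ha : IsDigit a)
    (hx : ((a + b * ((1 - goldenElt) * u) : cyclotomicIntegers 10) : ℂ)
      ∉ spectrumOf (polygonAlphabet 10) b) :
    ∃ i ∈ ({0, 3, 7} : Finset ℕ), a = u * genElt 10 ^ i := by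
  set w := genElt 10 with hw
  have h4 := quartic_of_isPrimitiveRoot_ten (isPrimitiveRoot_genElt (n := 10) (by norm_num))
  rw [← hw] at h4
  have ht : goldenElt = w - w ^ 4 := rfl
  have e : a + b * ((1 - goldenElt) * u) = a - goldenElt * u := by
    rw [hb]; linear_combination (-goldenElt * u) * goldenElt_sq
  rw [e] at hx
  -- The excluded digits are those for which a - τu is a word of length one (`key1`) or two (`key2`)
  -- in base τ²; the cases below exhibit the words.
  have key1 : ∀ i, a - goldenElt * u ≠ u * w ^ i := fun i h => hx (by
    rw [h]; exact mem_spectrumOf_of_mem (isDigit_root_mul_pow hu i))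
  have key2 : ∀ c, IsDigit c → ∀ i, a - goldenElt * u ≠ c + goldenElt ^ 2 * (u * w ^ i) :=
    fun c hc i h => hx (by
      rw [h, ← hb]
      exact add_mul_mem_spectrumOf hc (mem_spectrumOf_of_mem (isDigit_root_mul_pow hu i)))
  rcases (isDigit_iff (by norm_num)).1 ha with rfl | ha
  · refine absurd ?_ (key2 _ (isDigit_root_mul_pow hu 0) 5)
    rw [ht, ← hw]
    linear_combination (u * (-1 - 2 * w - w ^ 2 + w ^ 4 + 2 * w ^ 5 + 2 * w ^ 6 - w ^ 8 - w ^ 9))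
      * h4
  obtain ⟨i, hi, rfl⟩ := exists_eq_mul_pow hu ha
  rw [← hw] at *
  interval_cases i
  · exact ⟨0, by simp, rfl⟩
  · refine absurd ?_ (key1 4)
    rw [ht]; ring
  · refine absurd ?_ (key2 _ (isDigit_root_mul_pow hu 9) 4)
    rw [ht, ← hw]
    linear_combination (u * (-w + w ^ 3 + w ^ 4 + w ^ 5 - w ^ 7 - w ^ 8)) * h4
  · exact ⟨3, by simp, rfl⟩
  · refine absurd ?_ (key2 _ (isDigit_root_mul_pow hu 7) 4)
    rw [ht, ← hw]
    linear_combination (u * (-w - w ^ 2 + 2 * w ^ 4 + 2 * w ^ 5 - w ^ 7 - w ^ 8)) * h4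
  · refine absurd ?_ (key2 0 ((isDigit_iff (by norm_num)).2 (Or.inl rfl)) 5)
    rw [ht]
    linear_combination (u * (-w - w ^ 2 + w ^ 4 + 2 * w ^ 5 + 2 * w ^ 6 - w ^ 8 - w ^ 9)) * h4
  · refine absurd ?_ (key2 _ (isDigit_root_mul_pow hu 3) 6)
    rw [ht, ← hw]
    linear_combination (u * (-w - w ^ 2 - w ^ 3 + w ^ 5 + 2 * w ^ 6 + 2 * w ^ 7 - w ^ 9 - w ^ 10))
      * h4
  · exact ⟨7, by simp, rfl⟩
  · refine absurd ?_ (key2 _ (isDigit_root_mul_pow hu 1) 6)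
    rw [ht, ← hw]
    linear_combination (u * (-2 * w - 2 * w ^ 2 + w ^ 4 + w ^ 5 + 2 * w ^ 6 + 2 * w ^ 7 - w ^ 9
      - w ^ 10)) * h4
  · refine absurd ?_ (key1 6)
    rw [ht]
    linear_combination (u * (-w - w ^ 2 + w ^ 4 + w ^ 5)) * h4

/-- The coordinates of `x z` in terms of those of `z`, for `x` a primitive tenth root of unity. -/
def mulGenTen (v : ℤ × ℤ × ℤ × ℤ) : ℤ × ℤ × ℤ × ℤ :=
  (-v.2.2.2, v.1 + v.2.2.2, v.2.1 - v.2.2.2, v.2.2.1 + v.2.2.2)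

theorem evalQuad_mulGenTen_iterate {A : Type*} [CommRing A] [IsDomain A] {x : A}
    (hx : IsPrimitiveRoot x 10) (v : ℤ × ℤ × ℤ × ℤ) (i : ℕ) :
    evalQuad x (mulGenTen^[i] v) = x ^ i * evalQuad x v := by
  induction i with
  | zero => simp
  | succ i ih =>
    rw [Function.iterate_succ_apply', pow_succ', mul_assoc, ← ih]
    simp only [evalQuad, mulGenTen]
    push_cast
    linear_combination (-((mulGenTen^[i] v).2.2.2 : A)) * quartic_of_isPrimitiveRoot_ten hx

/-- An integer certificate for p + qτ ≥ 8 - 4τ = (2/(τ²-1))²: since q + 4 ≥ 0, τ may be replaced by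
the smaller 1.618. The vector (1, 0, 1, -1) represents τ. -/
theorem normPairTen_pair_bound : ∀ i ∈ ({0, 3, 7} : Finset ℕ), ∀ i' ∈ ({0, 3, 7} : Finset ℕ),
    ∀ j ∈ Finset.Icc 3 7, (i = 0 ∧ i' = 0) ∨
      0 ≤ 1000 * ((normPairTen (mulGenTen^[i] (1, 0, 0, 0) - (1, 0, 1, -1)
          - mulGenTen^[j] (mulGenTen^[i'] (1, 0, 0, 0) - (1, 0, 1, -1)))).1 - 8)
        + 1618 * ((normPairTen (mulGenTen^[i] (1, 0, 0, 0) - (1, 0, 1, -1)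
          - mulGenTen^[j] (mulGenTen^[i'] (1, 0, 0, 0) - (1, 0, 1, -1)))).2 + 4) ∧
      -4 ≤ (normPairTen (mulGenTen^[i] (1, 0, 0, 0) - (1, 0, 1, -1)
          - mulGenTen^[j] (mulGenTen^[i'] (1, 0, 0, 0) - (1, 0, 1, -1)))).2 := by
  decide +kernel

theorem eq_zero_of_norm_sub_lt {u : cyclotomicIntegers 10} (hu : u ^ 10 = 1) {i i' j : ℕ}
    (hi : i ∈ ({0, 3, 7} : Finset ℕ)) (hi' : i' ∈ ({0, 3, 7} : Finset ℕ))
    (hj : j ∈ Finset.Icc 3 7)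
    (h : ‖((u * genElt 10 ^ i - goldenElt * u : cyclotomicIntegers 10) : ℂ)
      - (u * genElt 10 ^ j * genElt 10 ^ i' - goldenElt * (u * genElt 10 ^ j) :
        cyclotomicIntegers 10)‖ < 2 / (Real.goldenRatio ^ 2 - 1)) : i = 0 ∧ i' = 0 := by
  obtain ⟨hl, hu'⟩ := goldenRatio_bounds
  have hφ := Real.goldenRatio_sq
  refine (normPairTen_pair_bound i hi i' hi' j hj).resolve_right fun hb => ?_
  have hω := isPrimitiveRoot_rootOfUnity (n := 10) (by norm_num)
  set v := mulGenTen^[i] (1, 0, 0, 0) - (1, 0, 1, -1)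
    - mulGenTen^[j] (mulGenTen^[i'] (1, 0, 0, 0) - (1, 0, 1, -1)) with hv
  have hone : evalQuad (rootOfUnity 10) (1, 0, 0, 0) = 1 := by simp [evalQuad]
  have hgold : evalQuad (rootOfUnity 10) (1, 0, 1, -1) = (goldenElt : ℂ) := by
    rw [coe_goldenElt, ← rootOfUnity_ten_sub_pow, quartic_of_isPrimitiveRoot_ten hω]
    simp [evalQuad]; ring
  have e : ((u * genElt 10 ^ i - goldenElt * u : cyclotomicIntegers 10) : ℂ)
      - (u * genElt 10 ^ j * genElt 10 ^ i' - goldenElt * (u * genElt 10 ^ j) :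
        cyclotomicIntegers 10) = u * evalQuad (rootOfUnity 10) v := by
    rw [hv, evalQuad_sub, evalQuad_sub, evalQuad_mulGenTen_iterate hω,
      evalQuad_mulGenTen_iterate hω, evalQuad_sub, evalQuad_mulGenTen_iterate hω, hone, hgold]
    push_cast
    have : (genElt 10 : ℂ) = rootOfUnity 10 := rfl
    rw [this]
    ring
  have hun : ‖(u : ℂ)‖ = 1 :=
    norm_eq_one_of_pow_eq_one (n := 10) (by norm_num) (by simpa using congrArg Subtype.val hu)
  rw [e, norm_mul, hun, one_mul] at h
  have h2 := pow_lt_pow_left₀ h (norm_nonneg _) two_ne_zero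
  rw [norm_evalQuad_sq_ten hω rootOfUnity_ten_sub_pow] at h2
  have e2 : (2 / (Real.goldenRatio ^ 2 - 1)) ^ 2 = 8 - 4 * Real.goldenRatio := by
    rw [hφ, add_sub_cancel_right, div_pow, hφ, div_eq_iff (by linarith)]
    linear_combination 4 * hφ
  rw [e2] at h2
  obtain ⟨b1, b2⟩ := hb
  have b1' : (0 : ℝ) ≤ 1000 * ((normPairTen v).1 - 8) + 1618 * ((normPairTen v).2 + 4) := by
    exact_mod_cast b1
  have b2' : (-4 : ℝ) ≤ (normPairTen v).2 := by exact_mod_cast b2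
  nlinarith

/-- Two vertices far apart are never residues of the same element at the same level. -/
theorem not_residue_pair {b z : cyclotomicIntegers 10} (hb : b = goldenElt ^ 2)
    (hz : (z : ℂ) ∉ spectrumOf (polygonAlphabet 10) b) {u : cyclotomicIntegers 10}
    (hu : u ^ 10 = 1) {j : ℕ} (hj : j ∈ Finset.Icc 3 7) (k : ℕ)
    (h : Residue b z k ((1 - goldenElt) * u))
    (h' : Residue b z k ((1 - goldenElt) * (u * genElt 10 ^ j))) : False := by
  have hw := isPrimitiveRoot_genElt (n := 10) (by norm_num)
  have hu' : (u * genElt 10 ^ j) ^ 10 = 1 := by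
    rw [mul_pow, hu, ← pow_mul, mul_comm j, pow_mul, hw.pow_eq_one, one_pow, one_mul]
  have hβ : 1 < Real.goldenRatio ^ 2 := by
    rw [Real.goldenRatio_sq]; linarith [Real.goldenRatio_pos]
  have hbc : (b : ℂ) = (Real.goldenRatio ^ 2 : ℝ) := by
    rw [hb, SubmonoidClass.coe_pow, coe_goldenElt, Complex.ofReal_pow]
  induction k with
  | zero =>
    have e := h'.eq_of_zero.trans h.eq_of_zero.symm
    have hne : (1 - goldenElt) * u ≠ 0 := by
      refine mul_ne_zero ?_ fun h0 => by simp [h0] at hu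
      intro h0
      have : (1 : cyclotomicIntegers 10) = 0 := by
        linear_combination (-goldenElt) * h0 - goldenElt_sq
      exact one_ne_zero this
    have : genElt 10 ^ j = 1 := by
      apply mul_left_cancel₀ hne
      linear_combination e
    rw [Finset.mem_Icc] at hj
    exact hw.pow_ne_one_of_pos_of_lt (by omega) (by omega) this
  | succ k ih =>
    obtain ⟨a, ha, hr⟩ := h.exists_of_succ
    obtain ⟨a', ha', hr'⟩ := h'.exists_of_succ
    obtain ⟨i, hi, rfl⟩ := digit_of_notMem_spectrumOf hb hu ha (hr.notMem_spectrumOf hz)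
    obtain ⟨i', hi', rfl⟩ := digit_of_notMem_spectrumOf hb hu' ha' (hr'.notMem_spectrumOf hz)
    have step : ∀ c x : cyclotomicIntegers 10,
        c + b * ((1 - goldenElt) * x) = c - goldenElt * x := fun c x => by
      rw [hb]; linear_combination (-goldenElt * x) * goldenElt_sq
    rw [step] at hr hr'
    obtain ⟨rfl, rfl⟩ := eq_zero_of_norm_sub_lt hu hi hi' hj
      (hr.norm_sub_lt (by norm_num) hβ hbc hr')
    -- With both digits equal to the unit itself, the predecessor u - τu is the same vertex. The
    -- pair thus descends unchanged to level zero, where both would equal `z`.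
    refine ih ?_ ?_
    · convert hr using 1; ring
    · convert hr' using 1; ring

/-- Along an edge of its convex hull the attractor has gaps accumulating at the vertex `τ ξ`. -/
theorem vertex_add_notMem_attractorK {ξ : ℂ} (hξ : IsPrimitiveRoot ξ 10)
    (hs : ξ - ξ ^ 4 = (1 - Real.goldenRatio : ℝ)) (l : ℕ) :
    (Real.goldenRatio : ℂ) * ξ
      + ((Real.goldenRatio - 1) * (0.8 * (2 - Real.goldenRatio) ^ l) : ℝ)
      ∉ attractorK (2 - Real.goldenRatio : ℝ) (polygonAlphabet 10) := by
  obtain ⟨hl, hu⟩ := goldenRatio_bounds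
  have hφ := Real.goldenRatio_sq
  have h4 := quartic_of_isPrimitiveRoot_ten hξ
  have h5 := pow_five_of_isPrimitiveRoot_ten hξ
  have hconj := conj_of_isPrimitiveRoot_ten hξ
  set φ := Real.goldenRatio with hφdef
  set γ := 2 - φ with hγ
  have hγ0 : 0 < γ := by linarith
  have hγ1 : γ < 1 := by linarith
  have hgeo : HasSum (fun i => γ ^ i) φ := by
    have := hasSum_geometric_of_lt_one hγ0.le hγ1
    have e : (1 - γ)⁻¹ = φ := by
      rw [inv_eq_iff_eq_inv, eq_comm]
      exact inv_eq_of_mul_eq_one_right (by rw [hγ]; linear_combination hφ)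
    rwa [e] at this
  rintro ⟨c, hc, hsum⟩
  have hr1 : ξ.re = (1 - φ) / 2 := by
    have : ((2 * ξ.re : ℝ) : ℂ) = (1 - φ : ℝ) := by
      rw [← hs, ← Complex.add_conj, hconj]; ring
    have := Complex.ofReal_injective this
    linarith
  have hsc : ξ - ξ ^ 4 = 1 - φ := by rw [hs, Complex.ofReal_sub, Complex.ofReal_one]
  have hφc : (φ : ℂ) ^ 2 = φ + 1 := by exact_mod_cast hφ
  have hr2 : (ξ ^ 2).re = -φ / 2 := by
    have : ((2 * (ξ ^ 2).re : ℝ) : ℂ) = (-φ : ℝ) := by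
      rw [← Complex.add_conj, map_pow, hconj, Complex.ofReal_neg]
      linear_combination (ξ - ξ ^ 4 + 1 - φ) * hsc + hφc + 2 * h5
    have := Complex.ofReal_injective this
    linarith
  have hr3 : (ξ ^ 3).re = φ / 2 := by
    have e : ξ ^ 3 = -(starRingEnd ℂ) (ξ ^ 2) := by
      rw [map_pow, hconj]; linear_combination ξ ^ 3 * h5
    rw [e, Complex.neg_re, Complex.conj_re, hr2]; ring
  have hr4 : (ξ ^ 4).re = (φ - 1) / 2 := by
    have e : ξ ^ 4 = -(starRingEnd ℂ) ξ := by rw [hconj]; ring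
    rw [e, Complex.neg_re, Complex.conj_re, hr1]; ring
  have hper : ∀ j, (ξ ^ (j + 5)).re = -(ξ ^ j).re := fun j => by
    rw [pow_add, h5]; simp
  -- A supporting functional of the edge of the digit polygon joining ξ to ξ⁴.
  have hmax : ∀ a ∈ polygonAlphabet 10, (-(a * (ξ + ξ ^ 4))).re ≤ 1 + φ / 2 ∧
      ((-(a * (ξ + ξ ^ 4))).re = 1 + φ / 2 → a = ξ ∨ a = ξ ^ 4) := by
    intro a ha
    rcases (mem_polygonAlphabet_iff (by norm_num)).1 ha with rfl | ha
    · simp only [zero_mul, neg_zero, Complex.zero_re]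
      exact ⟨by linarith, fun h => by linarith⟩
    obtain ⟨j, hj, rfl⟩ := hξ.eq_pow_of_pow_eq_one ha
    have e : (-(ξ ^ j * (ξ + ξ ^ 4))).re = -((ξ ^ (j + 1)).re + (ξ ^ (j + 4)).re) := by
      rw [Complex.neg_re, mul_add, ← pow_succ, ← pow_add, Complex.add_re]
    rw [e]
    have h0 : (ξ ^ 0).re = 1 := by simp
    have h1 : (ξ ^ 1).re = (1 - φ) / 2 := by rw [pow_one, hr1]
    have r5 := hper 0
    have r6 := hper 1
    have r7 := hper 2
    have r8 := hper 3
    have r9 := hper 4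
    have r10 := hper 5
    have r11 := hper 6
    have r12 := hper 7
    have r13 := hper 8
    norm_num only [Nat.reduceAdd] at *
    interval_cases j
    · exact ⟨by linarith, fun h => by linarith⟩
    · exact ⟨by linarith, fun _ => Or.inl (pow_one ξ)⟩
    · exact ⟨by linarith, fun h => by linarith⟩
    · exact ⟨by linarith, fun h => by linarith⟩
    · exact ⟨by linarith, fun _ => Or.inr rfl⟩
    all_goals exact ⟨by linarith, fun h => by linarith⟩
  -- The point attains the largest value φ(1 + φ/2) of the functional on K, so each digit must be
  -- maximal.
  have hF : ∀ i, c i = ξ ∨ c i = ξ ^ 4 := by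
    have h1 := Complex.hasSum_re (hsum.mul_right (-(ξ + ξ ^ 4)))
    have h2 := (hgeo.mul_left (1 + φ / 2)).sub h1
    have e1 : (1 + φ / 2) * φ - ((φ * ξ + ((φ - 1) * (0.8 * γ ^ l) : ℝ)) * -(ξ + ξ ^ 4)).re
        = 0 := by
      have e : ((φ : ℂ) * ξ + ((φ - 1) * (0.8 * γ ^ l) : ℝ)) * -(ξ + ξ ^ 4)
          = (φ : ℂ) * (1 - ξ ^ 2) - (((φ - 1) * (0.8 * γ ^ l) : ℝ) : ℂ) * (ξ + ξ ^ 4) := by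
        linear_combination (-(φ : ℂ)) * h5
      rw [e, Complex.sub_re, Complex.re_ofReal_mul, Complex.re_ofReal_mul, Complex.sub_re,
        Complex.add_re, Complex.one_re, hr1, hr2, hr4]
      ring
    have e2 : ∀ i, (c i * (γ : ℂ) ^ i * -(ξ + ξ ^ 4)).re
        = (-(c i * (ξ + ξ ^ 4))).re * γ ^ i := fun i => by
      rw [mul_comm _ (γ ^ i), ← Complex.re_ofReal_mul, Complex.ofReal_pow]
      congr 1; ring
    rw [e1, hasSum_zero_iff_of_nonneg] at h2
    · intro i
      have h3 := congrFun h2 i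
      simp only [e2, Pi.zero_apply] at h3
      refine (hmax _ (hc i)).2 ?_
      rw [← sub_mul] at h3
      have := (mul_eq_zero.1 h3).resolve_right (pow_pos hγ0 i).ne'
      linarith
    · intro i
      simp only [e2]
      rw [← sub_mul]
      exact mul_nonneg (by linarith [(hmax _ (hc i)).1]) (pow_pos hγ0 i).le
  -- Since ξ⁴ - ξ = φ - 1, the edge carries a Cantor set of sums of γ^i with coefficients 0 and 1.
  have hd : ∃ d : ℕ → ℝ, (∀ i, d i = 0 ∨ d i = 1) ∧ HasSum (fun i => d i * γ ^ i) (0.8 * γ ^ l) := by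
    have hstep : ∀ i, ∃ d : ℝ, (d = 0 ∨ d = 1) ∧ c i = ξ + (φ - 1) * d := fun i => by
      rcases hF i with h | h
      · exact ⟨0, Or.inl rfl, by rw [h]; simp⟩
      · refine ⟨1, Or.inr rfl, ?_⟩
        rw [h, Complex.ofReal_one]; linear_combination -hsc
    choose d hd01 hcd using hstep
    refine ⟨d, hd01, ?_⟩
    have h1 := (hsum.sub ((Complex.hasSum_ofReal.2 hgeo).mul_left ξ)).mul_left
      ((φ - 1 : ℝ) : ℂ)⁻¹
    have hne : ((φ - 1 : ℝ) : ℂ) ≠ 0 := Complex.ofReal_ne_zero.2 (by linarith)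
    rw [← Complex.hasSum_ofReal]
    have e1 : ((0.8 * γ ^ l : ℝ) : ℂ) = ((φ - 1 : ℝ) : ℂ)⁻¹
        * ((φ : ℂ) * ξ + ((φ - 1) * (0.8 * γ ^ l) : ℝ) - ξ * φ) := by
      rw [eq_inv_mul_iff_mul_eq₀ hne, ← Complex.ofReal_mul]; ring
    have e2 : (fun i => ((d i * γ ^ i : ℝ) : ℂ)) = fun i => ((φ - 1 : ℝ) : ℂ)⁻¹
        * (c i * (γ : ℂ) ^ i - ξ * ((γ ^ i : ℝ) : ℂ)) := by
      funext i
      rw [eq_inv_mul_iff_mul_eq₀ hne, hcd, Complex.ofReal_mul, Complex.ofReal_pow,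
        Complex.ofReal_sub, Complex.ofReal_one]
      ring
    rw [e1, e2]
    exact h1
  obtain ⟨d, hd01, hds⟩ := hd
  have hnn : ∀ i, 0 ≤ d i * γ ^ i := fun i => by
    rcases hd01 i with h | h <;> rw [h]
    · rw [zero_mul]
    · positivity
  -- The gap: a digit 1 at a place i ≤ l contributes at least γ^l, while all later places together
  -- give at most (φ-1)γ^l. The factor 0.8 lies between φ - 1 and 1.
  have hzero : ∀ i ≤ l, d i = 0 := by
    intro i hi
    refine (hd01 i).resolve_right fun h1 => ?_
    have hle := le_hasSum hds i fun j _ => hnn j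
    rw [h1, one_mul] at hle
    have := pow_le_pow_of_le_one hγ0.le hγ1.le hi
    have := pow_pos hγ0 l
    linarith
  have htail := (hasSum_nat_add_iff' (l + 1)).2 hds
  rw [Finset.sum_eq_zero fun i hi => by rw [hzero i (by simpa [Nat.lt_succ_iff] using hi), zero_mul],
    sub_zero] at htail
  have hle := hasSum_le (fun i => ?_) htail (hgeo.mul_left (γ ^ (l + 1)))
  · have e : γ ^ (l + 1) * φ = (φ - 1) * γ ^ l := by
      rw [pow_succ, hγ]; linear_combination (-(2 - φ) ^ l) * hφ
    rw [e] at hle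
    have := pow_pos hγ0 l
    nlinarith
  · rw [← pow_add, add_comm i]
    rcases hd01 (l + 1 + i) with h | h <;> rw [h]
    · rw [zero_mul]; positivity
    · rw [one_mul]

theorem pow_eq_pow_of_mod_eq {A : Type*} [Monoid A] {x : A} {n i j : ℕ} (hx : x ^ n = 1)
    (h : i % n = j % n) : x ^ i = x ^ j := by
  rw [pow_eq_pow_mod i hx, h, ← pow_eq_pow_mod j hx]

theorem spectrumOf_of_goldenRatio_sq (h : IsAdmissiblePair 10 (Real.goldenRatio ^ 2))
    (σ : cyclotomicIntegers 10 ≃+* cyclotomicIntegers 10) (hσ : ‖(σ (baseElt h) : ℂ)‖ < 1)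
    {z : cyclotomicIntegers 10}
    (hz : (σ z : ℂ) ∈ interior (attractorK (σ (baseElt h)) (polygonAlphabet 10))) :
    (z : ℂ) ∈ spectrumOf (polygonAlphabet 10) (Real.goldenRatio ^ 2 : ℝ) := by
  obtain ⟨hl, hu⟩ := goldenRatio_bounds
  have hφ := Real.goldenRatio_sq
  have hwp : IsPrimitiveRoot (genElt 10) 10 := isPrimitiveRoot_genElt (by norm_num)
  have hηp := isPrimitiveRoot_map_genElt (n := 10) (by norm_num) σ
  have hbc : (baseElt h : ℂ) = (Real.goldenRatio ^ 2 : ℝ) := rfl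
  have hb : baseElt h = goldenElt ^ 2 := by
    apply Subtype.ext
    rw [SubmonoidClass.coe_pow, coe_goldenElt, hbc, Complex.ofReal_pow]
  have hσg : (σ goldenElt : ℂ) = σ (genElt 10) - σ (genElt 10) ^ 4 := by simp [goldenElt]
  have hσb : (σ (baseElt h) : ℂ) = (σ (genElt 10) - σ (genElt 10) ^ 4 : ℂ) ^ 2 := by
    rw [hb, ← hσg]; simp
  have hη : (σ (genElt 10) : ℂ) - σ (genElt 10) ^ 4 = (1 - Real.goldenRatio : ℝ) := by
    refine (sub_pow_four_of_isPrimitiveRoot_ten hηp).resolve_left fun hcon => ?_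
    rw [hσb, hcon, norm_pow, Complex.norm_real, Real.norm_of_nonneg (by linarith), hφ] at hσ
    linarith
  rw [hη] at hσb hσg
  have hγ : (σ (baseElt h) : ℂ) = (2 - Real.goldenRatio : ℝ) := by
    rw [hσb, ← Complex.ofReal_pow]
    congr 1
    linear_combination hφ
  have hγn : ‖(σ (baseElt h) : ℂ)‖ = 2 - Real.goldenRatio := by
    rw [hγ, Complex.norm_real, Real.norm_of_nonneg (by linarith)]
  have hunit : IsUnit (baseElt h) := by
    rw [hb]
    refine (IsUnit.of_mul_eq_one (goldenElt - 1) ?_).pow 2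
    linear_combination goldenElt_sq
  have hβ : 1 < Real.goldenRatio ^ 2 := by rw [hφ]; linarith
  have hK : ∀ x ∈ attractorK (σ (baseElt h) : ℂ) (polygonAlphabet 10), ‖x‖ ≤ Real.goldenRatio := by
    intro x hx
    refine (norm_le_of_mem_attractorK
      (fun a => norm_le_one_of_mem_polygonAlphabet (by norm_num)) hσ hx).trans_eq ?_
    rw [hγn, inv_eq_iff_eq_inv, eq_comm]
    exact inv_eq_of_mul_eq_one_right (by linear_combination hφ)
  have hclosed : IsClosed (attractorK (σ (baseElt h) : ℂ) (polygonAlphabet 10)) :=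
    isClosed_attractorK (fun a => norm_le_one_of_mem_polygonAlphabet (by norm_num))
      (finite_polygonAlphabet (by norm_num)) hσ
  by_contra hcon
  rw [← hbc] at hcon
  obtain ⟨k, hk⟩ : ∃ k : ℕ, ‖(z : ℂ)‖ / (Real.goldenRatio ^ 2) ^ k < 0.0001 := by
    have : Tendsto (fun k : ℕ => ‖(z : ℂ)‖ / (Real.goldenRatio ^ 2) ^ k) atTop (𝓝 0) :=
      tendsto_const_nhds.div_atTop (tendsto_pow_atTop_atTop_of_one_lt hβ)
    exact (this.eventually (gt_mem_nhds (by norm_num))).exists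
  have hvert : ∀ y, Residue (baseElt h) z k y →
      (σ y : ℂ) ∈ attractorK (σ (baseElt h)) (polygonAlphabet 10) →
      ∃ i < 10, y = (1 - goldenElt) * genElt 10 ^ i := by
    intro y hr hy
    have n1 := hr.norm_le (by norm_num) hβ hbc
    have e1 : 1 / (Real.goldenRatio ^ 2 - 1) = Real.goldenRatio - 1 := by
      rw [hφ, add_sub_cancel_right, div_eq_iff (by linarith)]; linear_combination -hφ
    rw [e1] at n1
    rcases eq_zero_or_eq_of_norm_le σ hη (by linarith) (hK _ hy) with rfl | ⟨u, hu, rfl⟩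
    · exact absurd (by simpa using zero_mem_spectrumOf (zero_mem_polygonAlphabet 10))
        (hr.notMem_spectrumOf hcon)
    · obtain ⟨i, hi, rfl⟩ := exists_eq_mul_pow (one_pow 10) hu
      exact ⟨i, hi, by rw [one_mul]⟩
  have hroot : ∀ i : ℕ, (genElt 10 ^ i) ^ 10 = 1 := fun i => by
    rw [← pow_mul, mul_comm, pow_mul, hwp.pow_eq_one, one_pow]
  have hpair : ∀ i i', i < 10 → i' < 10 → Residue (baseElt h) z k ((1 - goldenElt) * genElt 10 ^ i) →
      Residue (baseElt h) z k ((1 - goldenElt) * genElt 10 ^ i') →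
      (i' + 10 - i) % 10 ∉ Finset.Icc 3 7 := by
    intro i i' hi hi' hr hr' hmem
    refine not_residue_pair hb hcon (hroot i) hmem k hr ?_
    have : genElt 10 ^ i * genElt 10 ^ ((i' + 10 - i) % 10) = genElt 10 ^ i' := by
      rw [← pow_add]
      refine pow_eq_pow_of_mod_eq hwp.pow_eq_one ?_
      omega
    rwa [this]
  -- Vertices pairwise at most two steps apart on a cycle of ten lie among three consecutive ones,
  -- with middle `s`.
  obtain ⟨s, hs⟩ : ∃ s, ∀ i < 10, Residue (baseElt h) z k ((1 - goldenElt) * genElt 10 ^ i) →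
      i % 10 = s % 10 ∨ i % 10 = (s + 1) % 10 ∨ i % 10 = (s + 9) % 10 := by
    simp only [Finset.mem_Icc] at hpair
    by_cases hne : ∃ i < 10, Residue (baseElt h) z k ((1 - goldenElt) * genElt 10 ^ i)
    · obtain ⟨i₀, hi₀, h₀⟩ := hne
      by_cases h2 : Residue (baseElt h) z k ((1 - goldenElt) * genElt 10 ^ ((i₀ + 2) % 10))
      · refine ⟨i₀ + 1, fun i hi hr => ?_⟩
        have := hpair _ _ hi₀ hi h₀ hr
        have := hpair _ _ (Nat.mod_lt _ (by norm_num)) hi h2 hr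
        omega
      by_cases h8 : Residue (baseElt h) z k ((1 - goldenElt) * genElt 10 ^ ((i₀ + 8) % 10))
      · refine ⟨i₀ + 9, fun i hi hr => ?_⟩
        have := hpair _ _ hi₀ hi h₀ hr
        have := hpair _ _ (Nat.mod_lt _ (by norm_num)) hi h8 hr
        omega
      · refine ⟨i₀, fun i hi hr => ?_⟩
        have := hpair _ _ hi₀ hi h₀ hr
        have : i ≠ (i₀ + 2) % 10 := fun e => h2 (e ▸ hr)
        have : i ≠ (i₀ + 8) % 10 := fun e => h8 (e ▸ hr)
        omega
    · exact ⟨0, fun i hi hr => absurd ⟨i, hi, hr⟩ hne⟩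
  set e := genElt 10 ^ s with he
  have he10 : (σ e : ℂ) ^ 10 = 1 := by
    rw [he, map_pow, SubmonoidClass.coe_pow, ← pow_mul, mul_comm, pow_mul, hηp.pow_eq_one,
      one_pow]
  set t : ℕ → ℂ := fun m => σ e *
    ((Real.goldenRatio - 1) * (0.8 * (2 - Real.goldenRatio) ^ m) : ℝ) with ht
  have hlim : Tendsto t atTop (𝓝 0) := by
    have h0 : Tendsto (fun m : ℕ => (2 - Real.goldenRatio) ^ m) atTop (𝓝 0) :=
      tendsto_pow_atTop_nhds_zero_of_lt_one (by linarith) (by linarith)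
    have h1 := (h0.const_mul 0.8).const_mul (Real.goldenRatio - 1)
    have h2 := ((Complex.continuous_ofReal.tendsto _).comp h1).const_mul (σ e : ℂ)
    simpa only [mul_zero, Complex.ofReal_zero, ht, Function.comp_def] using h2
  have hfreq : ∃ᶠ m in atTop,
      (σ z : ℂ) + t m ∈ attractorK (σ (baseElt h)) (polygonAlphabet 10) := by
    refine Eventually.frequently ?_
    have : Tendsto (fun m => (σ z : ℂ) + t m) atTop (𝓝 (σ z)) := by
      simpa using hlim.const_add (σ z : ℂ)
    exact this.eventually (mem_interior_iff_mem_nhds.1 hz)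
  obtain ⟨y, hr, hy⟩ := exists_residue_of_frequently (by norm_num) hunit hfreq k
  have hyK : (σ y : ℂ) ∈ attractorK (σ (baseElt h)) (polygonAlphabet 10) := by
    refine hclosed.mem_of_frequently_of_tendsto hy ?_
    simpa using (hlim.div_const ((σ (baseElt h) : ℂ) ^ k)).const_add (σ y : ℂ)
  obtain ⟨i, hi, rfl⟩ := hvert y hr hyK
  -- With m = k + l, division by σ(β)^k turns the perturbation into the one with exponent l, the
  -- form required at a vertex.
  obtain ⟨m, hm, hkm⟩ := (hy.and_eventually (eventually_ge_atTop k)).exists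
  obtain ⟨l, rfl⟩ := Nat.exists_eq_add_of_le hkm
  have key : ∀ j : ℕ, i % 10 = (s + j) % 10 → (Real.goldenRatio : ℂ) * (σ (genElt 10) : ℂ) ^ j
      + ((Real.goldenRatio - 1) * (0.8 * (2 - Real.goldenRatio) ^ l) : ℝ)
      ∈ attractorK (2 - Real.goldenRatio : ℝ) (polygonAlphabet 10) := by
    intro j hj
    have hγ0 : ((2 - Real.goldenRatio : ℝ) : ℂ) ≠ 0 := Complex.ofReal_ne_zero.2 (by linarith)
    have h1 : (σ ((1 - goldenElt) * genElt 10 ^ i) : ℂ)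
        = σ e * ((Real.goldenRatio : ℂ) * (σ (genElt 10) : ℂ) ^ j) := by
      rw [pow_eq_pow_of_mod_eq hwp.pow_eq_one hj, pow_add, ← he, map_mul, map_mul, map_sub,
        map_one, MulMemClass.coe_mul, MulMemClass.coe_mul, AddSubgroupClass.coe_sub, hσg,
        OneMemClass.coe_one, Complex.ofReal_sub, Complex.ofReal_one]
      simp only [map_pow, SubmonoidClass.coe_pow]
      ring
    have h2 : t (k + l) / (σ (baseElt h) : ℂ) ^ k = σ e *
        ((Real.goldenRatio - 1) * (0.8 * (2 - Real.goldenRatio) ^ l) : ℝ) := by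
      rw [hγ, div_eq_iff (pow_ne_zero _ hγ0), ht]
      simp only [pow_add]
      rw [← Complex.ofReal_pow, mul_assoc, ← Complex.ofReal_mul]
      congr 2; ring
    rw [h1, h2, ← mul_add, hγ] at hm
    -- Rotation by σ(e)⁻¹ makes the perturbation a positive real.
    have := mul_mem_attractorK (u := (σ e : ℂ) ^ 9) (fun a ha => ?_) hm
    · rwa [← mul_assoc, ← pow_succ, he10, one_mul] at this
    · rw [mem_polygonAlphabet_iff (by norm_num)] at ha ⊢
      rcases ha with rfl | ha
      · simp
      · right; rw [mul_pow, ha, ← pow_mul, mul_comm 9, pow_mul, he10]; simp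
  -- At the middle vertex the point is τ plus a positive number, outside the disc of radius τ. The
  -- neighbours are τξ and τξ⁻¹ = τξ⁹, where the gap argument applies.
  rcases hs i hi hr with hj | hj | hj
  · have := hK _ (by rw [hγ]; exact key 0 hj)
    rw [pow_zero, mul_one, ← Complex.ofReal_add, Complex.norm_real] at this
    have hpos : 0 < (Real.goldenRatio - 1) * (0.8 * (2 - Real.goldenRatio) ^ l) := by
      have : 0 < 2 - Real.goldenRatio := by linarith
      have : 0 < Real.goldenRatio - 1 := by linarith
      positivity
    rw [Real.norm_of_nonneg (by linarith)] at this
    linarith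
  · exact vertex_add_notMem_attractorK hηp hη l (by simpa using key 1 hj)
  · refine vertex_add_notMem_attractorK (hηp.pow_of_coprime 9 (by norm_num)) ?_ l (key 9 hj)
    rw [← hη]
    generalize (σ (genElt 10) : ℂ) = x at *
    linear_combination (x ^ 4 - x * (x ^ 30 - x ^ 25 + x ^ 20 - x ^ 15 + x ^ 10 - x ^ 5 + 1))
      * pow_five_of_isPrimitiveRoot_ten hηp

theorem mainTheorem9 (n : ℕ) (β : ℝ) (h : IsAdmissiblePair n β)
    (σ : cyclotomicIntegers n ≃+* cyclotomicIntegers n)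
    (hσ : ‖(σ (baseElt h) : ℂ)‖ < 1)
    (Ω : Set ℂ)
    (hΩ : Ω = interior (attractorK (σ (baseElt h)) (polygonAlphabet n))) :
    cutAndProject n σ Ω ∩ Metric.closedBall 0 (1 / (β - 1)) ⊆
        spectrumOf (polygonAlphabet n) β ∩ Metric.closedBall 0 (1 / (β - 1)) ↔
      cutAndProject n σ Ω ⊆ spectrumOf (polygonAlphabet n) β := by
  subst hΩ
  refine ⟨fun hball => ?_, fun hsub => Set.inter_subset_inter_left _ hsub⟩
  rintro _ ⟨z, rfl, hz⟩
  have hadm := h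
  rcases hadm with ⟨rfl, rfl⟩ | ⟨rfl, rfl⟩ | ⟨rfl, rfl⟩
  · exact spectrumOf_of_goldenRatio h σ hσ
      (fun y hy hle => (hball ⟨⟨y, rfl, hy⟩, by simpa using hle⟩).1) hz
  · exact spectrumOf_of_goldenRatio_sq h σ hσ hz
  · exact spectrumOf_of_silverMean h σ hσ (interior_subset hz)
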